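/- Let $\mathcal Q\subset\mathbb R^3$ be open, $T^*\mathcal Q=\mathcal Q\times\mathbb R^3$ with coordinates $z=(q,p)$ and $d\mu=d^3q\,d^3p$. Write $[\,,]_{JL}$ for the Jacobi–Lie bracket of vector fields, $[U,V]_{JL}=(U\cdot\nabla)V-(V\cdot\nabla)U$. Let $\mathfrak g=\mathfrak X_{ham}(T^*\mathcal Q)$ be the space of vector fields $X_h=\nabla_p h\cdot\nabla_q-\nabla_q h\cdot\nabla_p$, $h\in C^\infty(T^*\mathcal Q)$, with Lie bracket $[\,,]=-[\,,]_{JL}$. Its dual $\mathfrak g^*$ is represented by the momentum variables $\Pi=\Pi_q\cdot dq+\Pi_p\cdot dp$: smooth one-forms on $T^*\mathcal Q$ whose support projects into a compact subset of $\mathcal Q$ and which decrease rapidly in $p$ with all derivatives. The pairing is $\langle\Pi,X\rangle=\int\Pi\cdot X\,d\mu$. A functional $K$ on $\mathfrak g^*$ is differentiable at $\Pi$ if there is $\delta K/\delta\Pi\in\mathfrak g$ with $\frac{d}{d\epsilon}K(\Pi+\epsilon R)|_{\epsilon=0}=\langle R,\delta K/\delta\Pi\rangle$ (a convergent integral) for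 all $R\in\mathfrak g^*$, and the Lie–Poisson bracket of the momentum-Vlasov dynamics is $\{K,H\}_{LP}(\Pi)=\int\Pi\cdot[\frac{\delta K}{\delta\Pi},\frac{\delta H}{\delta\Pi}]\,d\mu$. Let $\mathfrak s=\mathfrak X(\mathcal Q)\ltimes\mathcal F(\mathcal Q)$ be the space of pairs $\xi=(X,\phi)$ of a smooth vector field and a smooth function on $\mathcal Q$, with $[(X,\phi),(Y,\zeta)]_{SC}=([X,Y]_{JL},X(\zeta)-Y(\phi))$, and let $\mathfrak s^*$ be the space of pairs $(\rho,M)$, $\rho\in C_c^\infty(\mathcal Q)$, $M\in C_c^\infty(\mathcal Q;\mathbb R^3)$, with $\langle(\rho,M),(X,\phi)\rangle=\int_{\mathcal Q}(M\cdot X+\rho\phi)\,d^3q$. A functional $F$ on $\mathfrak s^*$ is differentiable at $(\rho,M)$ if its derivatives in all directions of $\mathfrak s^*$ are given through this pairing by an element $(\delta F/\delta M,\delta F/\delta\rho)\in\mathfrak s$. The compressible fluid bracket is $$\{F,G\}_{\mathfrak s^*}(\rho,M)=\int M\cdot\Big[\frac{\delta F}{\delta M},\frac{\delta G}{\delta M}\Big]d^3q+\int\rho\Big(\frac{\delta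 G}{\delta M}\cdot\nabla\frac{\delta F}{\delta\rho}-\frac{\delta F}{\delta M}\cdot\nabla\frac{\delta G}{\delta\rho}\Big)d^3q,\qquad [\,,]=-[\,,]_{JL}.$$ For $\xi=(X,\phi)\in\mathfrak s$ let $$\xi^{c*}=X^{c*}+X_\phi=X^i\frac{\partial}{\partial q^i}-\Big(p_i\frac{\partial X^i}{\partial q^j}+\frac{\partial\phi}{\partial q^j}\Big)\frac{\partial}{\partial p_j}.$$ Then $\xi^{c*}\in\mathfrak g$ and $[\xi,\eta]_{SC}^{c*}=[\xi^{c*},\eta^{c*}]_{JL}$ for $\xi,\eta\in\mathfrak s$, and the formulas $$\rho(q)=\int\nabla_q\cdot\Pi_p\,d^3p,\qquad M(q)=\int\big(\Pi_q+p\,(\nabla_q\cdot\Pi_p)\big)\,d^3p$$ (with convergent integrals) define a linear map $\Phi:\mathfrak g^*\to\mathfrak s^*$, $\Pi\mapsto(\rho,M)$, such that: 1. $\Phi$ is unchanged under $\Pi\mapsto\Pi+dk$ for smooth $k$ on $T^*\mathcal Q$ with $\Pi+dk\in\mathfrak g^*$, and it is the dual of the lift: $\langle\Phi(\Pi),\xi\rangle=\langle\Pi,\xi^{c*}\rangle$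 (a convergent integral) for all $\Pi\in\mathfrak g^*$, $\xi\in\mathfrak s$. 2. $\Phi$ is a momentum map for the action of $\mathfrak s$ on $\mathfrak g^*$ with generators $\Pi\mapsto-\mathcal L_{\xi^{c*}}\Pi$ (which lie in $\mathfrak g^*$): for each $\xi\in\mathfrak s$ the functional $J_\xi=\langle\Phi(\cdot),\xi\rangle$ has $\delta J_\xi/\delta\Pi=\xi^{c*}$, and $\{K,J_\xi\}_{LP}(\Pi)=\frac{d}{d\epsilon}K(\Pi-\epsilon\mathcal L_{\xi^{c*}}\Pi)|_{\epsilon=0}$ for every $\Pi$ and every functional $K$ differentiable at $\Pi$ for which the integral defining the bracket converges. 3. $\Phi$ is a Poisson map: if $F,G$ are differentiable at $\Phi(\Pi)$, then $F\circ\Phi$ and $G\circ\Phi$ are differentiable at $\Pi$, with derivatives the lifts of those of $F$ and $G$, the integral defining their bracket converges, and $\{F\circ\Phi,G\circ\Phi\}_{LP}(\Pi)=\{F,G\}_{\mathfrak s^*}(\Phi(\Pi))$. -/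

import Mathlib

open MeasureTheory Set TopologicalSpace
open scoped ContDiff Distributions SchwartzMap

noncomputable section

namespace PlasmaFluid

/-- Euclidean three-space: it carries the positions `q` and the canonical momenta `p`. -/
abbrev E3 : Type := EuclideanSpace ℝ (Fin 3)

/-- Points `z = (q, p)` of the phase space, tangent vectors to it and covectors on it, in canonical
coordinates. A tangent vector is `(q', p')`, a covector is `(π_q, π_p)`. -/
abbrev Z6 : Type := E3 × E3

/-- The particle phase space `T*Q = Q × ℝ³` over the configuration space `Q ⊆ ℝ³`. -/
def phase (Q : Opens E3) : Set Z6 := (Q : Set E3) ×ˢ univ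

/-- The partial derivative `∂f/∂x^j` of a real function on `ℝ³`. -/
def pd (f : E3 → ℝ) (j : Fin 3) (x : E3) : ℝ := fderiv ℝ f x (EuclideanSpace.single j 1)

/-- The gradient `∇f = (∂f/∂x^j)_j`. -/
def grad (f : E3 → ℝ) (x : E3) : E3 := WithLp.toLp 2 fun j => pd f j x

/-- The Euclidean product `a · b = ∑ a_i b_i` on `ℝ³`. -/
def dot (a b : E3) : ℝ := ∑ i, a i * b i

/-- The pairing `π · v = π_q · q' + π_p · p'` of a covector and a tangent vector of `T*Q`. -/
def pair (π v : Z6) : ℝ := dot π.1 v.1 + dot π.2 v.2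

/-! ### The Lie algebra of Hamiltonian vector fields on phase space -/

/-- The Hamiltonian vector field `X_h = ∇_p h · ∇_q - ∇_q h · ∇_p`. -/
def hamVF (h : Z6 → ℝ) (z : Z6) : Z6 :=
  (grad (fun p => h (z.1, p)) z.2, -grad (fun q => h (q, z.2)) z.1)

/-- `X` belongs to `𝔤 = 𝔛_ham(T*Q)`: on `T*Q` it is the Hamiltonian vector field of a smooth
function. (Only the values of `X` on `T*Q` matter.) -/
def IsHam (Q : Opens E3) (X : Z6 → Z6) : Prop :=
  ∃ h : Z6 → ℝ, ContDiffOn ℝ ∞ h (phase Q) ∧ EqOn X (hamVF h) (phase Q)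

/-- The Lie algebra bracket of `𝔤`: minus the Jacobi-Lie bracket of vector fields. -/
def gBracket (X Y : Z6 → Z6) (z : Z6) : Z6 := -VectorField.lieBracket ℝ X Y z

/-! ### Momentum variables: the dual `𝔤*` -/

/-- The momentum variables `Π = Π_q · dq + Π_p · dp` (a one-form, identified with the one-form
density `Π ⊗ dμ`, `dμ = d³q d³p`): smooth one-forms on `T*Q` whose support projects into a compact
subset of `Q` and which decrease rapidly, with all derivatives, in the momenta. Extension by zero
makes them Schwartz functions on `ℝ³ × ℝ³`. -/
def MomentumForm (Q : Opens E3) : Submodule ℝ 𝓢(Z6, Z6) where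
  carrier := {P | ∃ K : Set E3, IsCompact K ∧ K ⊆ (Q : Set E3) ∧ ∀ q ∉ K, ∀ p, P (q, p) = 0}
  zero_mem' := ⟨∅, isCompact_empty, empty_subset _, fun _ _ _ => rfl⟩
  add_mem' := by
    rintro A B ⟨K, hK, hKQ, hA⟩ ⟨L, hL, hLQ, hB⟩
    refine ⟨K ∪ L, hK.union hL, union_subset hKQ hLQ, fun q hq p => ?_⟩
    have h1 : q ∉ K := fun h => hq (Or.inl h)
    have h2 : q ∉ L := fun h => hq (Or.inr h)
    simp [hA q h1 p, hB q h2 p]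
  smul_mem' := by
    rintro c A ⟨K, hK, hKQ, hA⟩
    exact ⟨K, hK, hKQ, fun q hq p => by simp [hA q hq p]⟩

variable {Q : Opens E3}

/-- The one-form underlying a momentum variable, as a function of `z = (q, p)`. -/
def form (P : MomentumForm Q) : Z6 → Z6 := fun z => (P : 𝓢(Z6, Z6)) z

/-- `δK/δΠ = X` at `P`: `X` is an element of `𝔤` that represents the derivatives of `K` at `P` in
all directions through the `L²` pairing. -/
def HasGDeriv (K : MomentumForm Q → ℝ) (P : MomentumForm Q) (X : Z6 → Z6) : Prop :=
  IsHam Q X ∧ ∀ R : MomentumForm Q,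
    IntegrableOn (fun z => pair (form R z) (X z)) (phase Q) ∧
    HasDerivAt (fun ε : ℝ => K (P + ε • R)) (∫ z in phase Q, pair (form R z) (X z)) 0

open Classical in
/-- The variational derivative `δK/δΠ` at `P` (unique on `T*Q` when it exists). -/
def gDeriv (K : MomentumForm Q → ℝ) (P : MomentumForm Q) : Z6 → Z6 :=
  if h : ∃ X, HasGDeriv K P X then h.choose else 0

/-- The integrand `Π · [δK/δΠ, δH/δΠ]` of the Lie-Poisson bracket on `𝔤*`. -/
def lpIntegrand (K H : MomentumForm Q → ℝ) (P : MomentumForm Q) (z : Z6) : ℝ :=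
  pair (form P z) (gBracket (gDeriv K P) (gDeriv H P) z)

/-- The Lie-Poisson bracket `{K, H}(Π) = ∫ Π · [δK/δΠ, δH/δΠ] dμ` on `𝔤*`. -/
def lpBracket (K H : MomentumForm Q → ℝ) (P : MomentumForm Q) : ℝ :=
  ∫ z in phase Q, lpIntegrand K H P z

/-- The Lie derivative `L_X Π` of a one-form, evaluated on a tangent vector `v`:
`(L_X Π)_a v^a = (X^b ∂_b Π_a + Π_b ∂_a X^b) v^a`. -/
def lieDerivForm (X : Z6 → Z6) (π : Z6 → Z6) (z v : Z6) : ℝ :=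
  pair (fderiv ℝ π z (X z)) v + pair (π z) (fderiv ℝ X z v)

/-! ### The semidirect product algebra `𝔰 = 𝔛(Q) ⋉ F(Q)` -/

/-- A pair `ξ = (X, φ)` of a vector field and a function, given on `ℝ³`; only the values on `Q`
matter. -/
abbrev FluidPair : Type := (E3 → E3) × (E3 → ℝ)

/-- `ξ = (X, φ)` belongs to `𝔰`: both components are smooth on `Q`. -/
def IsFluid (Q : Opens E3) (ξ : FluidPair) : Prop :=
  ContDiffOn ℝ ∞ ξ.1 Q ∧ ContDiffOn ℝ ∞ ξ.2 Q

/-- The Schouten concomitant on pairs: `[(X, φ), (Y, ζ)] = ([X, Y], X(ζ) - Y(φ))`, with the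
Jacobi-Lie bracket of vector fields. -/
def scBracket (ξ η : FluidPair) : FluidPair :=
  (fun q => VectorField.lieBracket ℝ ξ.1 η.1 q,
    fun q => fderiv ℝ η.2 q (ξ.1 q) - fderiv ℝ ξ.2 q (η.1 q))

/-- The complete cotangent lift `X^{c*} = X^i ∂/∂q^i - p_i (∂X^i/∂q^j) ∂/∂p_j`. -/
def cotangentLift (X : E3 → E3) (z : Z6) : Z6 :=
  (X z.1, WithLp.toLp 2 fun j => -∑ i, z.2 i * pd (fun q => X q i) j z.1)

/-- The generator of momentum translations `X_φ = -∇_q φ · ∇_p`. -/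
def momentumTranslation (φ : E3 → ℝ) (z : Z6) : Z6 := (0, -grad φ z.1)

/-- The lift `(X, φ) ↦ X^{c*} + X_φ` from `𝔰` to `𝔤`. -/
def lift (ξ : FluidPair) (z : Z6) : Z6 := cotangentLift ξ.1 z + momentumTranslation ξ.2 z

/-! ### Compressible fluid variables: the dual `𝔰*` -/

/-- The fluid variables `(ρ, M)`: a density and a momentum density, smooth and compactly supported
in `Q`. -/
abbrev FluidDual (Q : Opens E3) : Type := 𝓓(Q, ℝ) × 𝓓(Q, E3)

/-- The pairing `⟨(ρ, M), (X, φ)⟩ = ∫ (M · X + ρ φ) d³q` of `𝔰*` and `𝔰`. -/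
def fluidPairing (m : FluidDual Q) (ξ : FluidPair) : ℝ :=
  ∫ q in (Q : Set E3), (dot (m.2 q) (ξ.1 q) + m.1 q * ξ.2 q)

/-- `(δF/δM, δF/δρ) = ξ` at `m`. -/
def HasFluidDeriv (F : FluidDual Q → ℝ) (m : FluidDual Q) (ξ : FluidPair) : Prop :=
  IsFluid Q ξ ∧ ∀ n : FluidDual Q,
    HasDerivAt (fun ε : ℝ => F (m + ε • n)) (fluidPairing n ξ) 0

open Classical in
/-- The variational derivative `(δF/δM, δF/δρ)` at `m` (unique on `Q` when it exists). -/
def fluidDeriv (F : FluidDual Q → ℝ) (m : FluidDual Q) : FluidPair :=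
  if h : ∃ ξ, HasFluidDeriv F m ξ then h.choose else 0

/-- The compressible fluid bracket
`{F, G}(ρ, M) = ∫ M · [δF/δM, δG/δM] d³q
  + ∫ ρ (δG/δM · ∇(δF/δρ) - δF/δM · ∇(δG/δρ)) d³q`,
where `[ , ]` is the Lie algebra bracket of vector fields, minus the Jacobi-Lie bracket. -/
def fluidBracket (F G : FluidDual Q → ℝ) (m : FluidDual Q) : ℝ :=
  (∫ q in (Q : Set E3),
      dot (m.2 q) (-VectorField.lieBracket ℝ (fluidDeriv F m).1 (fluidDeriv G m).1 q)) +
  ∫ q in (Q : Set E3),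
      m.1 q * (dot ((fluidDeriv G m).1 q) (grad (fluidDeriv F m).2 q) -
        dot ((fluidDeriv F m).1 q) (grad (fluidDeriv G m).2 q))

/-! ### The plasma-to-fluid map -/

/-- The divergence `∇_q · Π_p` at `(q, p)`. -/
def divqPp (P : MomentumForm Q) (q p : E3) : ℝ :=
  ∑ j, pd (fun q' => (form P (q', p)).2 j) j q

/-- The integrand `Π_q + p (∇_q · Π_p)` of the momentum density. -/
def momentumIntegrand (P : MomentumForm Q) (q p : E3) : E3 :=
  (form P (q, p)).1 + divqPp P q p • p

/-- `Φ` is the plasma-to-fluid map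
`ρ(q) = ∫ ∇_q · Π_p d³p`, `M(q) = ∫ (Π_q + p (∇_q · Π_p)) d³p`, with convergent integrals. -/
def IsPlasmaToFluid (Φ : MomentumForm Q →ₗ[ℝ] FluidDual Q) : Prop :=
  ∀ (P : MomentumForm Q) (q : E3),
    Integrable (fun p => divqPp P q p) ∧ Integrable (fun p => momentumIntegrand P q p) ∧
    (Φ P).1 q = ∫ p, divqPp P q p ∧ (Φ P).2 q = ∫ p, momentumIntegrand P q p

/-- `Φ` is unchanged when the differential `dk` of a function on `T*Q` is added to `Π`. -/
def IsGaugeInvariant (Φ : MomentumForm Q →ₗ[ℝ] FluidDual Q) : Prop :=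
  ∀ (P R : MomentumForm Q) (k : Z6 → ℝ), ContDiffOn ℝ ∞ k (phase Q) →
    (∀ z ∈ phase Q, form R z = form P z +
      (grad (fun q => k (q, z.2)) z.1, grad (fun p => k (z.1, p)) z.2)) →
    Φ R = Φ P

/-- The lift maps `𝔰` to `𝔤` and preserves the (Jacobi-Lie type) brackets. -/
def LiftIsHom (Q : Opens E3) : Prop :=
  ∀ ξ η : FluidPair, IsFluid Q ξ → IsFluid Q η →
    IsHam Q (lift ξ) ∧ IsFluid Q (scBracket ξ η) ∧
    EqOn (lift (scBracket ξ η)) (VectorField.lieBracket ℝ (lift ξ) (lift η)) (phase Q)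

/-- `Φ` is the dual of the lift: `⟨Φ(Π), ξ⟩ = ⟨Π, lift ξ⟩` for all `Π` in `𝔤*` and `ξ` in `𝔰`. -/
def IsDualOfLift (Φ : MomentumForm Q →ₗ[ℝ] FluidDual Q) : Prop :=
  ∀ (P : MomentumForm Q) (ξ : FluidPair), IsFluid Q ξ →
    IntegrableOn (fun z => pair (form P z) (lift ξ z)) (phase Q) ∧
    fluidPairing (Φ P) ξ = ∫ z in phase Q, pair (form P z) (lift ξ z)

/-- `Φ` is a momentum map for the action of `𝔰` on `𝔤*` that is induced by the lift and the
coadjoint action `Π ↦ -L_{lift ξ} Π`: this generator is a vector field `V` on `𝔤*`, and it is the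
Hamiltonian vector field of `J_ξ = ⟨Φ(·), ξ⟩`, that is, `{K, J_ξ}(Π)` is the derivative of `K` at
`Π` along `V(Π)` for every differentiable `K` for which the bracket integral converges. -/
def IsMomentumMap (Φ : MomentumForm Q →ₗ[ℝ] FluidDual Q) : Prop :=
  ∀ ξ : FluidPair, IsFluid Q ξ → ∃ V : MomentumForm Q → MomentumForm Q,
    (∀ P, ∀ z ∈ phase Q, ∀ v : Z6,
      pair (form (V P) z) v = -lieDerivForm (lift ξ) (form P) z v) ∧
    ∀ P, HasGDeriv (fun R => fluidPairing (Φ R) ξ) P (lift ξ) ∧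
      ∀ K : MomentumForm Q → ℝ, (∃ Y, HasGDeriv K P Y) →
        IntegrableOn (lpIntegrand K (fun R => fluidPairing (Φ R) ξ) P) (phase Q) →
        HasDerivAt (fun ε : ℝ => K (P + ε • V P))
          (lpBracket K (fun R => fluidPairing (Φ R) ξ) P) 0

/-- `Φ` is a Poisson map: `{F ∘ Φ, G ∘ Φ} = {F, G} ∘ Φ` at every `Π` such that `F` and `G` are
differentiable at `Φ(Π)`; moreover `F ∘ Φ` is then differentiable at `Π`, its derivative is the
lift of that of `F`, and the bracket integral converges. -/
def IsPoissonMap (Φ : MomentumForm Q →ₗ[ℝ] FluidDual Q) : Prop :=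
  ∀ (P : MomentumForm Q) (F G : FluidDual Q → ℝ) (ξ η : FluidPair),
    HasFluidDeriv F (Φ P) ξ → HasFluidDeriv G (Φ P) η →
    HasGDeriv (F ∘ Φ) P (lift ξ) ∧ HasGDeriv (G ∘ Φ) P (lift η) ∧
    IntegrableOn (lpIntegrand (F ∘ Φ) (G ∘ Φ) P) (phase Q) ∧
    lpBracket (F ∘ Φ) (G ∘ Φ) P = fluidBracket F G (Φ P)

end PlasmaFluid

end

/-! The lift of `ξ = (X, φ)` is the Hamiltonian vector field of `h = p · X(q) + φ(q)`, which is
`liftHam ξ`. By the product rule, the integrand of `M · X + ρ φ` over phase space equals `Π · ξ^{c*}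
+ ∑ ∂_{q_j} (h Π_{p_j})` (`fluidDensity_eq_pair_lift_add`). The divergence integrates to zero, so
`Φ` is the transpose of the lift.

The Poisson property is then formal. As `Φ` is linear, `δ(F ∘ Φ)/δΠ` is the lift of the derivative
of `F`; the lift is a Lie algebra homomorphism (`liftIsHom`), and duality carries the bracket over
to the fluid side. Gauge invariance is separate: when `Π = dk`, symmetry of second derivatives turns
the integrands of `ρ` and `M` into `p`-divergences.

For the momentum map, the Leibniz rule `X(Π · Y) = (L_X Π) · Y + Π · [X, Y]` is integrated, with `X`
the lift and `Y = δK/δΠ`; the left side must integrate to zero by Liouville's theorem. Since `Y` is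
an arbitrary Hamiltonian field, `Π · Y` is known to be smooth and integrable but not Schwartz. Hence
`integral_fderiv_lift_eq_zero` uses a cutoff in `p`, which works because a lift grows at most
linearly in `p`.

Elements of `𝔰` may be wild near the boundary of `Q`. As `Π` lives over a compact `K ⊆ Q`, `ξ` may
be replaced by a compactly supported pair with the same germs along `K`; its lift has temperate
growth, so products with `Π` remain Schwartz. The derivatives inside the Lie–Poisson bracket are
picked by choice, so uniqueness (`HasGDeriv.eqOn`) is needed to compute with them. -/

noncomputable section

namespace PlasmaFluid

open LineDeriv

/-! ### Smoothness of integrals of Schwartz functions over the fibres of a product. -/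

section FiberIntegral

variable {E F G : Type*} [NormedAddCommGroup E] [NormedSpace ℝ E]
  [NormedAddCommGroup F] [NormedSpace ℝ F] [NormedAddCommGroup G] [NormedSpace ℝ G]

/-- The restriction of a Schwartz function on `E × F` to the fibre over `q`. -/
def fiberSlice (f : 𝓢(E × F, G)) (q : E) : 𝓢(F, G) :=
  SchwartzMap.compCLMOfAntilipschitz ℝ (K := 1) (g := fun p : F => (q, p))
    (by
      have h : (fun p : F => (q, p)) =
          (fun _ : F => ((q, 0) : E × F)) + ContinuousLinearMap.inr ℝ E F := by
        ext p <;> simp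
      rw [h]
      fun_prop)
    (AntilipschitzWith.of_le_mul_dist fun x y => by simp [Prod.dist_eq]) f

variable [MeasureSpace F]

/-- Integration of a Schwartz function over the fibres of `E × F → E`. -/
def fiberIntegral (f : 𝓢(E × F, G)) (q : E) : G := ∫ p, f (q, p)

theorem fiberIntegral_smul (c : ℝ) (f : 𝓢(E × F, G)) (q : E) :
    fiberIntegral (c • f) q = c • fiberIntegral f q := by
  simpa [fiberIntegral] using integral_smul c fun p => f (q, p)

variable [FiniteDimensional ℝ F] [BorelSpace F]
  [(volume : Measure F).IsAddHaarMeasure]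

/-- The bound does not depend on `q`: `‖p‖ ≤ ‖(q, p)‖`, so Schwartz decay on the product gives decay
in `p` uniformly in `q`. It serves as the dominating function for differentiation under the
integral. -/
theorem exists_integrable_fiber_bound (f : 𝓢(E × F, G)) :
    ∃ b : F → ℝ, Integrable b ∧ ∀ q p, ‖f (q, p)‖ ≤ b p := by
  obtain ⟨C₀, hC₀⟩ := f.decay 0 0
  obtain ⟨C₁, hC₁⟩ := f.decay (volume : Measure F).integrablePower 0
  refine ⟨fun p => 2 ^ (volume : Measure F).integrablePower * (C₀ + C₁) *
    (1 + ‖p‖) ^ (-((volume : Measure F).integrablePower : ℝ)),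
    (Measure.integrable_pow_neg_integrablePower volume).const_mul _, fun q p => ?_⟩
  have h0 : ‖f (q, p)‖ ≤ C₀ := by simpa using hC₀.2 (q, p)
  have h1 : ‖p‖ ^ (0 + (volume : Measure F).integrablePower) * ‖f (q, p)‖ ≤ C₁ := by
    refine le_trans ?_ (by simpa using hC₁.2 (q, p))
    rw [zero_add]
    gcongr
    exact norm_snd_le (q, p)
  simpa using pow_mul_le_of_le_of_pow_mul_le (norm_nonneg p) (norm_nonneg _) h0 h1

theorem integrable_fiber (f : 𝓢(E × F, G)) (q : E) : Integrable fun p => f (q, p) :=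
  (fiberSlice f q).integrable

theorem fiberIntegral_add (f g : 𝓢(E × F, G)) (q : E) :
    fiberIntegral (f + g) q = fiberIntegral f q + fiberIntegral g q := by
  simpa [fiberIntegral] using integral_add (integrable_fiber f q) (integrable_fiber g q)

theorem hasFDerivAt_fiberIntegral (f : 𝓢(E × F, G)) (q : E) :
    HasFDerivAt (fiberIntegral f)
      (∫ p, (fderiv ℝ f (q, p)).comp (ContinuousLinearMap.inl ℝ E F)) q := by
  let f' : 𝓢(E × F, E →L[ℝ] G) :=
    ((SchwartzMap.fderivCLM ℝ (E × F) G f).postcompCLM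
      ((ContinuousLinearMap.compL ℝ E (E × F) G).flip (ContinuousLinearMap.inl ℝ E F)))
  obtain ⟨b, hb, hbf⟩ := exists_integrable_fiber_bound f'
  refine hasFDerivAt_integral_of_dominated_of_fderiv_le (s := univ) (bound := b)
    (F := fun q p => f (q, p)) (F' := fun q p => f' (q, p)) Filter.univ_mem
    (.of_forall fun x => (integrable_fiber f x).1) (integrable_fiber f q)
    (integrable_fiber f' q).1 (.of_forall fun p x _ => hbf x p) hb
    (.of_forall fun p x _ => ?_)
  exact (f.hasFDerivAt (x, p)).comp x (hasFDerivAt_prodMk_left x p)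

/-- The derivative is again a fibre integral of a Schwartz function, which closes the induction for
smoothness. -/
theorem fderiv_fiberIntegral (f : 𝓢(E × F, G)) (q v : E) :
    fderiv ℝ (fiberIntegral f) q v = fiberIntegral (∂_{((v, 0) : E × F)} f) q := by
  rw [(hasFDerivAt_fiberIntegral f q).fderiv]
  let f' : 𝓢(E × F, E →L[ℝ] G) :=
    ((SchwartzMap.fderivCLM ℝ (E × F) G f).postcompCLM
      ((ContinuousLinearMap.compL ℝ E (E × F) G).flip (ContinuousLinearMap.inl ℝ E F)))
  exact ContinuousLinearMap.integral_apply (integrable_fiber f' q) v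

theorem contDiff_fiberIntegral [FiniteDimensional ℝ E] (f : 𝓢(E × F, G)) :
    ContDiff ℝ ∞ (fiberIntegral f) := by
  refine contDiff_infty.2 fun n => ?_
  -- The function must vary, because the inductive step applies the hypothesis to `∂_{(y, 0)} f`.
  induction n generalizing f with
  | zero =>
    exact contDiff_zero.2 (Differentiable.continuous fun q =>
      (hasFDerivAt_fiberIntegral f q).differentiableAt)
  | succ n ih =>
    rw [Nat.cast_add_one]
    refine contDiff_succ_iff_fderiv_apply.2
      ⟨fun q => (hasFDerivAt_fiberIntegral f q).differentiableAt, by simp, fun y => ?_⟩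
    simp only [fderiv_fiberIntegral]
    exact ih _

end FiberIntegral

/-! ### Integrals of directional derivatives, and smooth cutoffs. -/

section IntegrationByParts

variable {E : Type*} [NormedAddCommGroup E] [NormedSpace ℝ E] [FiniteDimensional ℝ E]
  [MeasurableSpace E] [BorelSpace E] {μ : Measure E} [μ.IsAddHaarMeasure]

/-- Integration by parts against the constant function `1`. -/
theorem integral_fderiv_apply_eq_zero {f : E → ℝ} (v : E) (hf : Differentiable ℝ f)
    (hi : Integrable f μ) (hi' : Integrable (fun x => fderiv ℝ f x v) μ) :
    ∫ x, fderiv ℝ f x v ∂μ = 0 := by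
  simpa using integral_mul_fderiv_eq_neg_fderiv_mul_of_integrable (f := fun _ : E => (1 : ℝ))
    (g := f) (v := v) (μ := μ) (by simp) (by simpa using hi') (by simpa using hi)
    (fun _ _ => by fun_prop) fun x _ => hf x

theorem integral_lineDerivOp_eq_zero (f : 𝓢(E, ℝ)) (v : E) : ∫ x, ∂_{v} f x ∂μ = 0 :=
  integral_fderiv_apply_eq_zero v f.differentiable f.integrable (∂_{v} f).integrable

end IntegrationByParts

/-- A smooth function on an open set agrees, near a given compact subset, with a smooth compactly
supported function. -/
theorem exists_contDiff_extension {E G : Type*} [NormedAddCommGroup E] [NormedSpace ℝ E]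
    [FiniteDimensional ℝ E] [NormedAddCommGroup G] [NormedSpace ℝ G] {U K : Set E} {f : E → G}
    (hU : IsOpen U) (hK : IsCompact K) (hKU : K ⊆ U) (hf : ContDiffOn ℝ ∞ f U) :
    ∃ g : E → G, ContDiff ℝ ∞ g ∧ HasCompactSupport g ∧ ∀ x ∈ K, g =ᶠ[nhds x] f := by
  obtain ⟨L, hL, hKL, hLU⟩ := exists_compact_between hK hU hKU
  obtain ⟨χ, h1, h0, -⟩ := exists_contMDiffMap_one_nhds_of_subset_interior (n := ⊤)
    (modelWithCornersSelf ℝ E) hK.isClosed hKL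
  have hχ : ContDiff ℝ ∞ χ := χ.contMDiff.contDiff
  refine ⟨fun x => χ x • f x, ?_, ?_, fun x hx => ?_⟩
  · refine contDiff_iff_contDiffAt.2 fun x => ?_
    by_cases hx : x ∈ U
    · exact hχ.contDiffAt.smul (hf.contDiffAt (hU.mem_nhds hx))
    -- Nothing is known about `f` outside `U`, but the cutoff vanishes on the open complement of
    -- `L`.
    · refine (contDiffAt_const (c := (0 : G))).congr_of_eventuallyEq ?_
      filter_upwards [hL.isClosed.isOpen_compl.mem_nhds fun h => hx (hLU h)] with y hy
      rw [h0 y hy, zero_smul]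
  · exact HasCompactSupport.intro hL fun x hx => by rw [h0 x hx, zero_smul]
  · filter_upwards [(eventually_nhdsSet_iff_forall.1 h1) x hx] with y hy
    rw [hy, one_smul]

/-! ### Coordinates on phase space -/

/-- The coordinate vector `∂/∂q^j`. -/
def qDir (j : Fin 3) : Z6 := (EuclideanSpace.single j 1, 0)

/-- The coordinate vector `∂/∂p_j`. -/
def pDir (j : Fin 3) : Z6 := (0, EuclideanSpace.single j 1)

theorem sum_smul_single (v : E3) : ∑ j, v j • EuclideanSpace.single j (1 : ℝ) = v := by
  ext i
  simp [Finset.sum_apply, Pi.single_apply]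

theorem sum_smul_qDir_add_pDir (v : Z6) : ∑ j, (v.1 j • qDir j + v.2 j • pDir j) = v := by
  rw [Finset.sum_add_distrib]
  refine Prod.ext ?_ ?_
  · simpa [qDir, pDir, Prod.fst_sum] using sum_smul_single v.1
  · simpa [qDir, pDir, Prod.snd_sum] using sum_smul_single v.2

theorem clm_apply_eq_sum {G : Type*} [NormedAddCommGroup G] [NormedSpace ℝ G] (L : E3 →L[ℝ] G)
    (v : E3) : L v = ∑ j, v j • L (EuclideanSpace.single j 1) := by
  conv_lhs => rw [← sum_smul_single v]
  simp

theorem clm_apply_eq_sum_dir {G : Type*} [NormedAddCommGroup G] [NormedSpace ℝ G] (L : Z6 →L[ℝ] G)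
    (v : Z6) : L v = ∑ j, (v.1 j • L (qDir j) + v.2 j • L (pDir j)) := by
  conv_lhs => rw [← sum_smul_qDir_add_pDir v]
  simp

theorem pd_fst {f : Z6 → ℝ} {z : Z6} (hf : DifferentiableAt ℝ f z) (j : Fin 3) :
    pd (fun q => f (q, z.2)) j z.1 = fderiv ℝ f z (qDir j) := by
  have h : HasFDerivAt (fun q => f (q, z.2)) ((fderiv ℝ f z).comp (.inl ℝ E3 E3)) z.1 :=
    HasFDerivAt.comp (g := f) z.1 hf.hasFDerivAt (hasFDerivAt_prodMk_left z.1 z.2)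
  simp [pd, h.fderiv, qDir]

theorem pd_snd {f : Z6 → ℝ} {z : Z6} (hf : DifferentiableAt ℝ f z) (j : Fin 3) :
    pd (fun p => f (z.1, p)) j z.2 = fderiv ℝ f z (pDir j) := by
  have h : HasFDerivAt (fun p => f (z.1, p)) ((fderiv ℝ f z).comp (.inr ℝ E3 E3)) z.2 :=
    HasFDerivAt.comp (g := f) z.2 hf.hasFDerivAt (hasFDerivAt_prodMk_right z.1 z.2)
  simp [pd, h.fderiv, pDir]

theorem dot_eq_inner (a b : E3) : dot a b = innerSL ℝ a b := by
  simp [dot, PiLp.inner_apply, mul_comm]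

/-- The pairing of covectors and tangent vectors as a continuous bilinear form. -/
def pairCLM : Z6 →L[ℝ] Z6 →L[ℝ] ℝ :=
  (innerSL ℝ : E3 →L[ℝ] E3 →L[ℝ] ℝ).bilinearComp (.fst ℝ E3 E3) (.fst ℝ E3 E3) +
    (innerSL ℝ : E3 →L[ℝ] E3 →L[ℝ] ℝ).bilinearComp (.snd ℝ E3 E3) (.snd ℝ E3 E3)

theorem pair_eq_pairCLM (a b : Z6) : pair a b = pairCLM a b := by
  simp [pair, pairCLM, dot_eq_inner]

/-- The `j`-th component of `Π_p` as a functional of the covector `Π`. -/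
def pCoord (j : Fin 3) : Z6 →L[ℝ] ℝ := (EuclideanSpace.proj j).comp (.snd ℝ E3 E3)

@[simp] theorem pCoord_apply (j : Fin 3) (a : Z6) : pCoord j a = a.2 j := rfl

theorem isOpen_phase (Q : Opens E3) : IsOpen (phase Q) := Q.isOpen.prod isOpen_univ

theorem mem_phase {Q : Opens E3} {z : Z6} : z ∈ phase Q ↔ z.1 ∈ Q := by simp [phase]

/-! ### Hamiltonian vector fields -/

theorem hamVF_fst {h : Z6 → ℝ} {z : Z6} (hh : DifferentiableAt ℝ h z) (j : Fin 3) :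
    (hamVF h z).1 j = fderiv ℝ h z (pDir j) := pd_snd hh j

theorem hamVF_snd {h : Z6 → ℝ} {z : Z6} (hh : DifferentiableAt ℝ h z) (j : Fin 3) :
    (hamVF h z).2 j = -fderiv ℝ h z (qDir j) := by
  simpa [hamVF, grad] using pd_fst hh j

/-- The Hamiltonian `p · X(q) + φ(q)` of the lift of `(X, φ)`. -/
def liftHam (ξ : FluidPair) (z : Z6) : ℝ := dot z.2 (ξ.1 z.1) + ξ.2 z.1

theorem contDiffOn_liftHam {Q : Opens E3} {ξ : FluidPair} (hξ : IsFluid Q ξ) :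
    ContDiffOn ℝ ∞ (liftHam ξ) (phase Q) := by
  have hm : MapsTo (Prod.fst : Z6 → E3) (phase Q) Q := fun z hz => mem_phase.1 hz
  have h1 := hξ.1.comp contDiff_fst.contDiffOn hm
  have h2 := hξ.2.comp contDiff_fst.contDiffOn hm
  have h3 : ContDiffOn ℝ ∞ (fun z : Z6 => dot z.2 (ξ.1 z.1)) (phase Q) := by
    simp_rw [dot_eq_inner, innerSL_apply_apply]
    exact contDiff_snd.contDiffOn.inner ℝ h1
  exact h3.add h2

theorem hamVF_liftHam {ξ : FluidPair} {z : Z6} (h1 : DifferentiableAt ℝ ξ.1 z.1)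
    (h2 : DifferentiableAt ℝ ξ.2 z.1) : hamVF (liftHam ξ) z = lift ξ z := by
  have hc : ∀ i, DifferentiableAt ℝ (fun q => ξ.1 q i) z.1 := fun i =>
    (EuclideanSpace.proj i : E3 →L[ℝ] ℝ).differentiableAt.comp z.1 h1
  refine Prod.ext ?_ ?_
  · ext j
    have h : HasFDerivAt (fun p => liftHam ξ (z.1, p)) (innerSL ℝ (ξ.1 z.1)) z.2 := by
      have : (fun p => liftHam ξ (z.1, p)) = fun p => innerSL ℝ (ξ.1 z.1) p + ξ.2 z.1 := by
        ext p
        simp [liftHam, dot_eq_inner, real_inner_comm]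
      rw [this]
      exact (innerSL ℝ (ξ.1 z.1)).hasFDerivAt.add_const _
    simp [hamVF, grad, pd, h.fderiv, lift, cotangentLift, momentumTranslation,
      EuclideanSpace.inner_single_right]
  · ext j
    have h : HasFDerivAt (fun q => liftHam ξ (q, z.2))
        ((∑ i, z.2 i • fderiv ℝ (fun q => ξ.1 q i) z.1) + fderiv ℝ ξ.2 z.1) z.1 :=
      (HasFDerivAt.fun_sum fun i _ => ((hc i).hasFDerivAt.const_mul (z.2 i))).add h2.hasFDerivAt
    simp [hamVF, grad, pd, h.fderiv, lift, cotangentLift, momentumTranslation]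
    ring

theorem IsFluid.isHam_lift {Q : Opens E3} {ξ : FluidPair} (hξ : IsFluid Q ξ) :
    IsHam Q (lift ξ) := by
  refine ⟨liftHam ξ, contDiffOn_liftHam hξ, fun z hz => (hamVF_liftHam ?_ ?_).symm⟩
  · exact (hξ.1.contDiffAt (Q.isOpen.mem_nhds (mem_phase.1 hz))).differentiableAt (by simp)
  · exact (hξ.2.contDiffAt (Q.isOpen.mem_nhds (mem_phase.1 hz))).differentiableAt (by simp)

/-! ### Compactly supported fluid pairs -/

/-- Pairs `(X, φ)` of smooth compactly supported components. -/
structure IsFluidTest (ξ : FluidPair) : Prop where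
  contDiff_fst : ContDiff ℝ ∞ ξ.1
  contDiff_snd : ContDiff ℝ ∞ ξ.2
  hasCompactSupport_fst : HasCompactSupport ξ.1
  hasCompactSupport_snd : HasCompactSupport ξ.2

theorem IsFluid.exists_test {Q : Opens E3} {ξ : FluidPair} (hξ : IsFluid Q ξ) {K : Set E3}
    (hK : IsCompact K) (hKQ : K ⊆ Q) :
    ∃ η : FluidPair, IsFluidTest η ∧ ∀ q ∈ K, η.1 =ᶠ[nhds q] ξ.1 ∧ η.2 =ᶠ[nhds q] ξ.2 := by
  obtain ⟨X, h1, h2, h3⟩ := exists_contDiff_extension Q.isOpen hK hKQ hξ.1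
  obtain ⟨φ, h4, h5, h6⟩ := exists_contDiff_extension Q.isOpen hK hKQ hξ.2
  exact ⟨(X, φ), ⟨h1, h4, h2, h5⟩, fun q hq => ⟨h3 q hq, h6 q hq⟩⟩

/-- The lift contains first derivatives of the pair, so equal values do not suffice. The conclusion
is about germs because the Lie derivative differentiates the lift once more. -/
theorem lift_congr {ξ η : FluidPair} {z : Z6} (h1 : η.1 =ᶠ[nhds z.1] ξ.1)
    (h2 : η.2 =ᶠ[nhds z.1] ξ.2) : lift η =ᶠ[nhds z] lift ξ := by
  have hfst : Filter.Tendsto (Prod.fst : Z6 → E3) (nhds z) (nhds z.1) := continuous_fst.tendsto z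
  filter_upwards [hfst.eventually h1.eventuallyEq_nhds, hfst.eventually h2.eventuallyEq_nhds]
    with w hw1 hw2
  have h3 : ∀ i, (fun q => η.1 q i) =ᶠ[nhds w.1] fun q => ξ.1 q i := fun i =>
    hw1.mono fun q hq => by simp only [hq]
  simp only [lift, cotangentLift, momentumTranslation, grad, pd, hw1.eq_of_nhds, hw2.fderiv_eq,
    (h3 _).fderiv_eq]

theorem IsFluidTest.hasTemperateGrowth_fst {ξ : FluidPair} (hξ : IsFluidTest ξ) :
    (fun z : Z6 => ξ.1 z.1).HasTemperateGrowth :=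
  (hξ.hasCompactSupport_fst.hasTemperateGrowth hξ.contDiff_fst).comp
    (ContinuousLinearMap.fst ℝ E3 E3).hasTemperateGrowth

theorem IsFluidTest.hasTemperateGrowth_snd {ξ : FluidPair} (hξ : IsFluidTest ξ) :
    (fun z : Z6 => ξ.2 z.1).HasTemperateGrowth :=
  (hξ.hasCompactSupport_snd.hasTemperateGrowth hξ.contDiff_snd).comp
    (ContinuousLinearMap.fst ℝ E3 E3).hasTemperateGrowth

theorem IsFluidTest.hasTemperateGrowth_liftHam {ξ : FluidPair} (hξ : IsFluidTest ξ) :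
    (liftHam ξ).HasTemperateGrowth := by
  have h : liftHam ξ = fun z : Z6 => innerSL ℝ (ContinuousLinearMap.snd ℝ E3 E3 z) (ξ.1 z.1) +
      ξ.2 z.1 := by
    ext z
    simp [liftHam, dot_eq_inner]
  rw [h]
  exact ((innerSL ℝ).bilinear_hasTemperateGrowth
    (ContinuousLinearMap.snd ℝ E3 E3).hasTemperateGrowth hξ.hasTemperateGrowth_fst).add
      hξ.hasTemperateGrowth_snd

theorem hasTemperateGrowth_fderiv {E F : Type*} [NormedAddCommGroup E] [NormedSpace ℝ E]
    [NormedAddCommGroup F] [NormedSpace ℝ F] {f : E → F} (hf : f.HasTemperateGrowth) :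
    (fderiv ℝ f).HasTemperateGrowth := by
  refine ⟨(contDiff_infty_iff_fderiv.1 hf.1).2, fun n => ?_⟩
  obtain ⟨k, C, h⟩ := hf.2 (n + 1)
  exact ⟨k, C, fun x => by simpa [norm_iteratedFDeriv_fderiv] using h x⟩

/-- The linear map `α ↦ X_h`, where `α = dh`. -/
def sharp : (Z6 →L[ℝ] ℝ) →L[ℝ] Z6 :=
  ∑ j, ((ContinuousLinearMap.apply ℝ ℝ (pDir j)).smulRight (qDir j) -
    (ContinuousLinearMap.apply ℝ ℝ (qDir j)).smulRight (pDir j))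

theorem hamVF_eq_sharp {h : Z6 → ℝ} {z : Z6} (hh : DifferentiableAt ℝ h z) :
    hamVF h z = sharp (fderiv ℝ h z) := by
  rw [← sum_smul_qDir_add_pDir (hamVF h z)]
  simp [sharp, hamVF_fst hh, hamVF_snd hh, sub_eq_add_neg]

theorem contDiffOn_hamVF {Q : Opens E3} {h : Z6 → ℝ} (hh : ContDiffOn ℝ ∞ h (phase Q)) :
    ContDiffOn ℝ ∞ (hamVF h) (phase Q) := by
  refine ContDiffOn.congr (sharp.contDiff.comp_contDiffOn
    (hh.fderiv_of_isOpen (isOpen_phase Q) (m := ∞) (by simp))) fun z hz => ?_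
  exact hamVF_eq_sharp
    ((hh.contDiffAt ((isOpen_phase Q).mem_nhds hz)).differentiableAt (by simp))

theorem IsHam.contDiffOn {Q : Opens E3} {X : Z6 → Z6} (hX : IsHam Q X) :
    ContDiffOn ℝ ∞ X (phase Q) := by
  obtain ⟨h, hh, hX⟩ := hX
  exact (contDiffOn_hamVF hh).congr hX

theorem IsFluidTest.hamVF_liftHam {ξ : FluidPair} (hξ : IsFluidTest ξ) (z : Z6) :
    hamVF (liftHam ξ) z = lift ξ z :=
  PlasmaFluid.hamVF_liftHam (hξ.contDiff_fst.differentiable (by simp) _)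
    (hξ.contDiff_snd.differentiable (by simp) _)

theorem IsFluidTest.differentiable_liftHam {ξ : FluidPair} (hξ : IsFluidTest ξ) :
    Differentiable ℝ (liftHam ξ) := hξ.hasTemperateGrowth_liftHam.1.differentiable (by simp)

theorem IsFluidTest.lift_eq_sharp {ξ : FluidPair} (hξ : IsFluidTest ξ) (z : Z6) :
    lift ξ z = sharp (fderiv ℝ (liftHam ξ) z) := by
  rw [← hξ.hamVF_liftHam, hamVF_eq_sharp (hξ.differentiable_liftHam z)]

theorem IsFluidTest.hasTemperateGrowth_lift {ξ : FluidPair} (hξ : IsFluidTest ξ) :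
    (lift ξ).HasTemperateGrowth := by
  rw [funext hξ.lift_eq_sharp]
  exact sharp.hasTemperateGrowth.comp (hasTemperateGrowth_fderiv hξ.hasTemperateGrowth_liftHam)

variable {Q : Opens E3}

/-! ### The plasma-to-fluid map -/

/-- The support of `f` projects into a compact subset of `Q`. -/
def BaseSupported {G : Type*} [Zero G] (Q : Opens E3) (f : Z6 → G) : Prop :=
  ∃ K : Set E3, IsCompact K ∧ K ⊆ (Q : Set E3) ∧ ∀ q ∉ K, ∀ p, f (q, p) = 0

theorem eventuallyEq_zero_of_notMem {G : Type*} [Zero G] {f : Z6 → G} {K : Set E3}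
    (hK : IsCompact K) (hf : ∀ q ∉ K, ∀ p, f (q, p) = 0) {z : Z6} (hz : z.1 ∉ K) :
    f =ᶠ[nhds z] 0 := by
  filter_upwards [(continuous_fst.tendsto z).eventually
    (hK.isClosed.isOpen_compl.mem_nhds hz)] with w hw
  exact hf w.1 hw w.2

theorem fderiv_eq_zero_of_notMem {G : Type*} [NormedAddCommGroup G] [NormedSpace ℝ G] {f : Z6 → G}
    {K : Set E3} (hK : IsCompact K) (hf : ∀ q ∉ K, ∀ p, f (q, p) = 0) {z : Z6} (hz : z.1 ∉ K) :
    fderiv ℝ f z = 0 := by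
  rw [(eventuallyEq_zero_of_notMem hK hf hz).fderiv_eq]
  simp

/-- The fibre integral of a Schwartz function with base support in `Q`, as a test function. -/
def fiberIntegralTest {G : Type*} [NormedAddCommGroup G] [NormedSpace ℝ G] (f : 𝓢(Z6, G))
    (hf : BaseSupported Q f) : 𝓓(Q, G) where
  toFun := fiberIntegral f
  contDiff' := contDiff_fiberIntegral f
  hasCompactSupport' := by
    obtain ⟨K, hK, -, h⟩ := hf
    exact HasCompactSupport.intro hK fun q hq => by simp [fiberIntegral, h q hq]
  tsupport_subset' := by
    obtain ⟨K, hK, hKQ, h⟩ := hf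
    refine (closure_minimal (fun q hq => ?_) hK.isClosed).trans hKQ
    by_contra hqK
    exact hq (by simp [fiberIntegral, h q hqK])

/-- The divergence `∇_q · Π_p` as a Schwartz function on phase space. -/
def divSchwartz : 𝓢(Z6, Z6) →L[ℝ] 𝓢(Z6, ℝ) :=
  ∑ j, (SchwartzMap.postcompCLM (pCoord j)) ∘L lineDerivOpCLM ℝ 𝓢(Z6, Z6) (qDir j)

theorem divSchwartz_apply (P : 𝓢(Z6, Z6)) (z : Z6) :
    divSchwartz P z = ∑ j, (fderiv ℝ P z (qDir j)).2 j := by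
  simp only [divSchwartz, sum_apply]
  rfl

/-- The momentum density `Π_q + p (∇_q · Π_p)` as a Schwartz function on phase space. -/
def momSchwartz : 𝓢(Z6, Z6) →L[ℝ] 𝓢(Z6, E3) :=
  SchwartzMap.postcompCLM (.fst ℝ E3 E3) +
    (SchwartzMap.bilinLeftCLM (ContinuousLinearMap.lsmul ℝ ℝ)
      (ContinuousLinearMap.snd ℝ E3 E3).hasTemperateGrowth) ∘L divSchwartz

theorem momSchwartz_apply (P : 𝓢(Z6, Z6)) (z : Z6) :
    momSchwartz P z = (P z).1 + divSchwartz P z • z.2 := rfl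

theorem divqPp_eq (P : MomentumForm Q) (q p : E3) :
    divqPp P q p = divSchwartz (P : 𝓢(Z6, Z6)) (q, p) := by
  rw [divSchwartz_apply]
  refine Finset.sum_congr rfl fun j _ => ?_
  have hd : DifferentiableAt ℝ (P : 𝓢(Z6, Z6)) (q, p) := SchwartzMap.differentiableAt _
  have h : HasFDerivAt (fun z => (form P z).2 j) ((pCoord j).comp (fderiv ℝ (P : 𝓢(Z6, Z6)) (q, p)))
      (q, p) := (pCoord j).hasFDerivAt.comp (q, p) hd.hasFDerivAt
  have h' := pd_fst (z := (q, p)) h.differentiableAt j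
  rw [h.fderiv] at h'
  exact h'

theorem momentumIntegrand_eq (P : MomentumForm Q) (q p : E3) :
    momentumIntegrand P q p = momSchwartz (P : 𝓢(Z6, Z6)) (q, p) := by
  rw [momSchwartz_apply, ← divqPp_eq]
  rfl

theorem baseSupported_divSchwartz (P : MomentumForm Q) :
    BaseSupported Q (divSchwartz (P : 𝓢(Z6, Z6))) := by
  obtain ⟨K, hK, hKQ, h⟩ := P.2
  refine ⟨K, hK, hKQ, fun q hq p => ?_⟩
  rw [divSchwartz_apply, fderiv_eq_zero_of_notMem hK h (z := (q, p)) hq]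
  simp

theorem baseSupported_momSchwartz (P : MomentumForm Q) :
    BaseSupported Q (momSchwartz (P : 𝓢(Z6, Z6))) := by
  obtain ⟨K, hK, hKQ, h⟩ := P.2
  refine ⟨K, hK, hKQ, fun q hq p => ?_⟩
  rw [momSchwartz_apply, divSchwartz_apply, fderiv_eq_zero_of_notMem hK h (z := (q, p)) hq,
    h q hq]
  simp

/-- The plasma-to-fluid map `Π ↦ (ρ, M)`. -/
def plasmaToFluid (Q : Opens E3) : MomentumForm Q →ₗ[ℝ] FluidDual Q where
  toFun P := (fiberIntegralTest _ (baseSupported_divSchwartz P),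
    fiberIntegralTest _ (baseSupported_momSchwartz P))
  map_add' P R := by
    refine Prod.ext ?_ ?_
    · ext1 q
      change fiberIntegral (divSchwartz ((P : 𝓢(Z6, Z6)) + R)) q = _
      rw [map_add, fiberIntegral_add]
      rfl
    · ext1 q
      change fiberIntegral (momSchwartz ((P : 𝓢(Z6, Z6)) + R)) q = _
      rw [map_add, fiberIntegral_add]
      rfl
  map_smul' c P := by
    refine Prod.ext ?_ ?_
    · ext1 q
      change fiberIntegral (divSchwartz (c • (P : 𝓢(Z6, Z6)))) q = _
      rw [map_smul, fiberIntegral_smul]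
      rfl
    · ext1 q
      change fiberIntegral (momSchwartz (c • (P : 𝓢(Z6, Z6)))) q = _
      rw [map_smul, fiberIntegral_smul]
      rfl

theorem plasmaToFluid_fst (P : MomentumForm Q) (q : E3) :
    (plasmaToFluid Q P).1 q = fiberIntegral (divSchwartz (P : 𝓢(Z6, Z6))) q := rfl

theorem plasmaToFluid_snd (P : MomentumForm Q) (q : E3) :
    (plasmaToFluid Q P).2 q = fiberIntegral (momSchwartz (P : 𝓢(Z6, Z6))) q := rfl

theorem isPlasmaToFluid_plasmaToFluid : IsPlasmaToFluid (plasmaToFluid Q) := by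
  intro P q
  simp only [divqPp_eq, momentumIntegrand_eq]
  exact ⟨integrable_fiber _ q, integrable_fiber _ q, rfl, rfl⟩

/-! ### Gauge invariance -/

/-- On a fixed fibre, `∂/∂p_j` is a directional derivative of the Schwartz function `fiberSlice f
q`. -/
theorem integral_fiber_lineDerivOp_eq_zero (f : 𝓢(Z6, ℝ)) (q : E3) (j : Fin 3) :
    ∫ p, ∂_{pDir j} f (q, p) = 0 := by
  rw [← integral_lineDerivOp_eq_zero (μ := (volume : Measure E3)) (fiberSlice f q)
    (EuclideanSpace.single j 1)]
  refine integral_congr_ae (.of_forall fun p => ?_)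
  have h : HasFDerivAt (fiberSlice f q) ((fderiv ℝ f (q, p)).comp (.inr ℝ E3 E3)) p :=
    HasFDerivAt.comp (g := f) p (f.hasFDerivAt (q, p)) (hasFDerivAt_prodMk_right q p)
  change fderiv ℝ f (q, p) (pDir j) = fderiv ℝ (fiberSlice f q) p _
  rw [h.fderiv]
  simp [pDir]

/-- If `Π` is closed in the mixed directions, then `ρ = 0` and `M = 0`. -/
theorem plasmaToFluid_eq_zero_of_closed (P : MomentumForm Q)
    (hP : ∀ z i j, (fderiv ℝ (form P) z (qDir i)).2 j = (fderiv ℝ (form P) z (pDir j)).1 i) :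
    plasmaToFluid Q P = 0 := by
  let S : Fin 3 → 𝓢(Z6, ℝ) := fun j =>
    (P : 𝓢(Z6, Z6)).postcompCLM ((EuclideanSpace.proj j).comp (.fst ℝ E3 E3) : Z6 →L[ℝ] ℝ)
  have hd : ∀ z, HasFDerivAt (form P) (fderiv ℝ (form P) z) z :=
    (P : 𝓢(Z6, Z6)).hasFDerivAt
  have hSd : ∀ j z, HasFDerivAt (S j)
      (((EuclideanSpace.proj j).comp (.fst ℝ E3 E3) : Z6 →L[ℝ] ℝ).comp (fderiv ℝ (form P) z)) z :=
    fun j z => ((EuclideanSpace.proj j).comp (.fst ℝ E3 E3) : Z6 →L[ℝ] ℝ).hasFDerivAt.comp z (hd z)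
  have hS : ∀ j i z, ∂_{pDir i} (S j) z = (fderiv ℝ (form P) z (pDir i)).1 j := fun j i z => by
    rw [SchwartzMap.lineDerivOp_apply_eq_fderiv, (hSd j z).fderiv]
    rfl
  have hdiv : ∀ z, divSchwartz (P : 𝓢(Z6, Z6)) z = ∑ j, ∂_{pDir j} (S j) z := fun z => by
    rw [divSchwartz_apply]
    exact Finset.sum_congr rfl fun j _ => (hP z j j).trans (hS j j z).symm
  refine Prod.ext ?_ ?_
  · ext1 q
    rw [plasmaToFluid_fst]
    simp only [fiberIntegral, hdiv]
    rw [integral_finsetSum _ fun j _ => integrable_fiber _ q]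
    exact Finset.sum_eq_zero fun j _ => integral_fiber_lineDerivOp_eq_zero _ q j
  · ext q i
    rw [plasmaToFluid_snd]
    have hg : (pCoord i : Z6 → ℝ).HasTemperateGrowth := (pCoord i).hasTemperateGrowth
    -- `T j = p_i Π_{q_j}`. Since `∂p_i/∂p_j = δ_ij`, its `p`-divergence is `Π_{q_i} + p_i ∑ ∂_{p_j}
    -- Π_{q_j}`, the `i`-th component of the integrand of `M`.
    let T : Fin 3 → 𝓢(Z6, ℝ) := fun j => SchwartzMap.smulLeftCLM ℝ (pCoord i) (S j)
    have hT : ∀ j z, ∂_{pDir j} (T j) z = z.2 i * ∂_{pDir j} (S j) z +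
        (if i = j then 1 else 0) * S j z := fun j z => by
      have h : HasFDerivAt (T j) (z.2 i • fderiv ℝ (S j) z + S j z • pCoord i) z := by
        have h0 : (T j : Z6 → ℝ) = fun w => pCoord i w * S j w :=
          SchwartzMap.smulLeftCLM_apply hg (S j)
        rw [h0]
        exact (pCoord i).hasFDerivAt.mul ((S j).hasFDerivAt z)
      rw [SchwartzMap.lineDerivOp_apply_eq_fderiv, h.fderiv]
      simp [pDir, SchwartzMap.lineDerivOp_apply_eq_fderiv]
    have hm : ∀ z, (momSchwartz (P : 𝓢(Z6, Z6)) z) i = ∑ j, ∂_{pDir j} (T j) z := fun z => by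
      simp only [hT, Finset.sum_add_distrib, ← Finset.mul_sum, momSchwartz_apply, hdiv]
      simp [S, mul_comm, add_comm]
    have hi : ∫ p, (momSchwartz (P : 𝓢(Z6, Z6)) (q, p)) i =
        (∫ p, momSchwartz (P : 𝓢(Z6, Z6)) (q, p)) i :=
      (EuclideanSpace.proj i : E3 →L[ℝ] ℝ).integral_comp_comm
        (integrable_fiber (momSchwartz (P : 𝓢(Z6, Z6))) q)
    refine hi.symm.trans ?_
    simp only [hm]
    rw [integral_finsetSum _ fun j _ => integrable_fiber _ q]
    exact Finset.sum_eq_zero fun j _ => integral_fiber_lineDerivOp_eq_zero _ q j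

theorem isGaugeInvariant_plasmaToFluid : IsGaugeInvariant (plasmaToFluid Q) := by
  intro P R k hk hR
  rw [← sub_eq_zero, ← map_sub]
  refine plasmaToFluid_eq_zero_of_closed _ fun z i j => ?_
  have hform : form (R - P) = fun z => form R z - form P z := rfl
  by_cases hz : z ∈ phase Q
  · have hkd : ∀ w ∈ phase Q, ContDiffAt ℝ ∞ k w := fun w hw =>
      hk.contDiffAt ((isOpen_phase Q).mem_nhds hw)
    have hd : DifferentiableAt ℝ (form (R - P)) z :=
      ((R - P : MomentumForm Q) : 𝓢(Z6, Z6)).differentiableAt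
    have e1 : (fun w => (form (R - P) w).1 i) =ᶠ[nhds z] fun w => fderiv ℝ k w (qDir i) := by
      filter_upwards [(isOpen_phase Q).mem_nhds hz] with w hw
      rw [← pd_fst ((hkd w hw).differentiableAt (by simp)), hform]
      simp [hR w hw, grad]
    have e2 : (fun w => (form (R - P) w).2 j) =ᶠ[nhds z] fun w => fderiv ℝ k w (pDir j) := by
      filter_upwards [(isOpen_phase Q).mem_nhds hz] with w hw
      rw [← pd_snd ((hkd w hw).differentiableAt (by simp)), hform]
      simp [hR w hw, grad]
    have hk2 : DifferentiableAt ℝ (fderiv ℝ k) z :=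
      ((hkd z hz).fderiv_right (m := ∞) (by simp)).differentiableAt (by simp)
    have hsymm : IsSymmSndFDerivAt ℝ k z := (hkd z hz).isSymmSndFDerivAt
      (by simpa using WithTop.coe_le_coe.2 (le_top : (2 : ℕ∞) ≤ ⊤))
    have f1 : HasFDerivAt (fun w => (form (R - P) w).1 i)
        (((EuclideanSpace.proj i).comp (.fst ℝ E3 E3) : Z6 →L[ℝ] ℝ).comp
          (fderiv ℝ (form (R - P)) z)) z :=
      ((EuclideanSpace.proj i).comp (.fst ℝ E3 E3) : Z6 →L[ℝ] ℝ).hasFDerivAt.comp z hd.hasFDerivAt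
    have f2 : HasFDerivAt (fun w => (form (R - P) w).2 j)
        ((pCoord j).comp (fderiv ℝ (form (R - P)) z)) z :=
      (pCoord j).hasFDerivAt.comp z hd.hasFDerivAt
    have g1 : ∀ u v, fderiv ℝ (fun w => fderiv ℝ k w u) z v = fderiv ℝ (fderiv ℝ k) z v u :=
      fun u v => by
        rw [fderiv_clm_apply hk2 (differentiableAt_const u)]
        simp
    calc (fderiv ℝ (form (R - P)) z (qDir i)).2 j
        = fderiv ℝ (fun w => (form (R - P) w).2 j) z (qDir i) := by rw [f2.fderiv]; rfl
      _ = fderiv ℝ (fun w => (form (R - P) w).1 i) z (pDir j) := by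
        rw [e1.fderiv_eq, e2.fderiv_eq, g1, g1, hsymm.eq]
      _ = (fderiv ℝ (form (R - P)) z (pDir j)).1 i := by rw [f1.fderiv]; rfl
  -- Off `T*Q` nothing is known about `k`, but the form vanishes near such a point.
  · obtain ⟨K, hK, hKQ, h⟩ := (R - P).2
    have h0 : fderiv ℝ (form (R - P)) z = 0 :=
      fderiv_eq_zero_of_notMem hK h fun h => hz (mem_phase.2 (hKQ h))
    simp [h0]

instance : (volume : Measure Z6).IsAddHaarMeasure :=
  inferInstanceAs ((volume : Measure E3).prod (volume : Measure E3)).IsAddHaarMeasure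

instance : (volume : Measure Z6).HasTemperateGrowth :=
  Measure.IsAddHaarMeasure.instHasTemperateGrowth

/-! ### Duality with the lift -/

/-- The function `Π · X` for a Schwartz one-form `Π` and a vector field `X` of temperate growth. -/
def pairSchwartz {X : Z6 → Z6} (hX : X.HasTemperateGrowth) (P : 𝓢(Z6, Z6)) : 𝓢(Z6, ℝ) :=
  SchwartzMap.bilinLeftCLM pairCLM hX P

theorem pairSchwartz_apply {X : Z6 → Z6} (hX : X.HasTemperateGrowth) (P : 𝓢(Z6, Z6)) (z : Z6) :
    pairSchwartz hX P z = pair (P z) (X z) := (pair_eq_pairCLM _ _).symm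

/-- With `h = liftHam ξ`, the left side is `Π_q · X + h (∇_q · Π_p)`. On the right, the product rule
gives `h (∇_q · Π_p) + Π_p · ∇_q h`, and the last term cancels against the momentum part `-∇_q h` of
the lift. -/
theorem fluidDensity_eq_pair_lift_add {ξ : FluidPair} (hξ : IsFluidTest ξ) (P : 𝓢(Z6, Z6)) (z : Z6) :
    dot (momSchwartz P z) (ξ.1 z.1) + divSchwartz P z * ξ.2 z.1 =
      pair (P z) (lift ξ z) +
        ∑ j, fderiv ℝ (fun w => liftHam ξ w * (P w).2 j) z (qDir j) := by
  have hH := hξ.differentiable_liftHam z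
  have h : ∀ j, HasFDerivAt (fun w => liftHam ξ w * (P w).2 j)
      (liftHam ξ z • (pCoord j).comp (fderiv ℝ P z) + (P z).2 j • fderiv ℝ (liftHam ξ) z) z :=
    fun j => hH.hasFDerivAt.mul ((pCoord j).hasFDerivAt.comp z (P.hasFDerivAt z))
  have h1 : (lift ξ z).1 = ξ.1 z.1 := by simp [lift, cotangentLift, momentumTranslation]
  have h2 : ∀ j, (lift ξ z).2 j = -fderiv ℝ (liftHam ξ) z (qDir j) := fun j => by
    rw [← hξ.hamVF_liftHam, hamVF_snd hH]
  simp only [(h _).fderiv, pair, h1, momSchwartz_apply]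
  simp only [dot, h2, divSchwartz_apply, liftHam, add_apply,
    smul_apply, ContinuousLinearMap.comp_apply, pCoord_apply, smul_eq_mul,
    PiLp.add_apply, PiLp.smul_apply, Fin.sum_univ_three]
  ring

/-- Fubini, followed by the pointwise identity. The divergence terms vanish because `h Π_{p_j}` is
Schwartz when `h` has temperate growth. -/
theorem integral_fluidDensity {ξ : FluidPair} (hξ : IsFluidTest ξ) (P : 𝓢(Z6, Z6)) :
    ∫ q, (dot (fiberIntegral (momSchwartz P) q) (ξ.1 q) +
      fiberIntegral (divSchwartz P) q * ξ.2 q) = ∫ z, pair (P z) (lift ξ z) := by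
  let A : 𝓢(Z6, ℝ) := SchwartzMap.bilinLeftCLM (innerSL ℝ) hξ.hasTemperateGrowth_fst
    (momSchwartz P) + SchwartzMap.bilinLeftCLM (ContinuousLinearMap.mul ℝ ℝ)
      hξ.hasTemperateGrowth_snd (divSchwartz P)
  have hA : ∀ z, A z = dot (momSchwartz P z) (ξ.1 z.1) + divSchwartz P z * ξ.2 z.1 := fun z => by
    rw [dot_eq_inner]
    rfl
  let T : Fin 3 → 𝓢(Z6, ℝ) := fun j =>
    SchwartzMap.smulLeftCLM ℝ (liftHam ξ) (P.postcompCLM (pCoord j))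
  have hT : ∀ j, (T j : Z6 → ℝ) = fun w => liftHam ξ w * (P w).2 j := fun j =>
    SchwartzMap.smulLeftCLM_apply hξ.hasTemperateGrowth_liftHam _
  calc _ = ∫ q, fiberIntegral A q := by
        refine integral_congr_ae (.of_forall fun q => ?_)
        have h1 : ∫ p, (innerSL ℝ).flip (ξ.1 q) (momSchwartz P (q, p)) =
            (innerSL ℝ).flip (ξ.1 q) (∫ p, momSchwartz P (q, p)) :=
          ContinuousLinearMap.integral_comp_comm _ (integrable_fiber (momSchwartz P) q)
        have i1 := ((innerSL ℝ).flip (ξ.1 q)).integrable_comp (integrable_fiber (momSchwartz P) q)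
        have i2 := (integrable_fiber (divSchwartz P) q).mul_const (ξ.2 q)
        simp only [fiberIntegral, hA, dot_eq_inner]
        refine Eq.trans ?_ (integral_add i1 i2).symm
        rw [h1, integral_mul_const]
        rfl
    _ = ∫ z, A z := (integral_prod _ (A.integrable (μ := volume))).symm
    _ = ∫ z, (pairSchwartz hξ.hasTemperateGrowth_lift P z + ∑ j, ∂_{qDir j} (T j) z) := by
        refine integral_congr_ae (.of_forall fun z => ?_)
        simp only [hA, fluidDensity_eq_pair_lift_add hξ, pairSchwartz_apply, ← hT]
        rfl
    _ = ∫ z, pairSchwartz hξ.hasTemperateGrowth_lift P z := by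
        rw [integral_add (SchwartzMap.integrable _)
            (integrable_finsetSum _ fun j _ => SchwartzMap.integrable _),
          integral_finsetSum _ fun j _ => SchwartzMap.integrable _]
        simp [integral_lineDerivOp_eq_zero]
    _ = _ := by simp only [pairSchwartz_apply]

theorem pair_zero_left (v : Z6) : pair 0 v = 0 := by simp [pair, dot]

theorem dot_zero_left (v : E3) : dot 0 v = 0 := by simp [dot]

/-- Every element of `𝔰` agrees, near the support of a given momentum variable, with a compactly
supported one. -/
theorem exists_test_of_form (P : MomentumForm Q) {ξ : FluidPair} (hξ : IsFluid Q ξ) :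
    ∃ (K : Set E3) (η : FluidPair), IsCompact K ∧ K ⊆ (Q : Set E3) ∧
      (∀ q ∉ K, ∀ p, form P (q, p) = 0) ∧ IsFluidTest η ∧
      ∀ q ∈ K, η.1 =ᶠ[nhds q] ξ.1 ∧ η.2 =ᶠ[nhds q] ξ.2 := by
  obtain ⟨K, hK, hKQ, hP⟩ := P.2
  obtain ⟨η, hη, h⟩ := hξ.exists_test hK hKQ
  exact ⟨K, η, hK, hKQ, hP, hη, h⟩

theorem form_eq_zero_of_notMem_phase (P : MomentumForm Q) {z : Z6} (hz : z ∉ phase Q) :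
    form P z = 0 := by
  obtain ⟨K, -, hKQ, hP⟩ := P.2
  exact hP z.1 (fun h => hz (mem_phase.2 (hKQ h))) z.2

theorem isDualOfLift_plasmaToFluid : IsDualOfLift (plasmaToFluid Q) := by
  intro P ξ hξ
  obtain ⟨K, η, hK, hKQ, hP, hη, hηξ⟩ := exists_test_of_form P hξ
  have e1 : (fun z => pair (form P z) (lift ξ z)) =
      pairSchwartz hη.hasTemperateGrowth_lift (P : 𝓢(Z6, Z6)) := by
    ext z
    rw [pairSchwartz_apply]
    by_cases hz : z.1 ∈ K
    · rw [← (lift_congr (hηξ z.1 hz).1 (hηξ z.1 hz).2).eq_of_nhds]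
      rfl
    · have h0 : form P z = 0 := hP z.1 hz z.2
      have h0' : (P : 𝓢(Z6, Z6)) z = 0 := h0
      rw [h0, h0', pair_zero_left, pair_zero_left]
  have e2 : ∀ q, dot ((plasmaToFluid Q P).2 q) (ξ.1 q) + (plasmaToFluid Q P).1 q * ξ.2 q =
      dot (fiberIntegral (momSchwartz (P : 𝓢(Z6, Z6))) q) (η.1 q) +
        fiberIntegral (divSchwartz (P : 𝓢(Z6, Z6))) q * η.2 q := fun q => by
    rw [plasmaToFluid_fst, plasmaToFluid_snd]
    by_cases hq : q ∈ K
    · rw [(hηξ q hq).1.eq_of_nhds, (hηξ q hq).2.eq_of_nhds]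
    · have h0 : ∀ p, fderiv ℝ (P : 𝓢(Z6, Z6)) (q, p) = 0 := fun p =>
        fderiv_eq_zero_of_notMem hK hP (z := (q, p)) hq
      have h1 : ∀ p, (P : 𝓢(Z6, Z6)) (q, p) = 0 := hP q hq
      simp [fiberIntegral, momSchwartz_apply, divSchwartz_apply, h0, h1, dot_zero_left]
  refine ⟨?_, ?_⟩
  · rw [e1]
    exact (SchwartzMap.integrable _).integrableOn
  · rw [fluidPairing, setIntegral_eq_integral_of_forall_compl_eq_zero,
      setIntegral_eq_integral_of_forall_compl_eq_zero]
    · refine (integral_congr_ae (.of_forall e2)).trans ?_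
      rw [integral_fluidDensity hη, e1]
      exact integral_congr_ae (.of_forall fun z => (pairSchwartz_apply _ _ z).symm)
    · intro z hz
      rw [form_eq_zero_of_notMem_phase P hz, pair_zero_left]
    · intro q hq
      have h1 : (plasmaToFluid Q P).1 q = 0 := image_eq_zero_of_notMem_tsupport
        fun h => hq ((plasmaToFluid Q P).1.tsupport_subset h)
      have h2 : (plasmaToFluid Q P).2 q = 0 := image_eq_zero_of_notMem_tsupport
        fun h => hq ((plasmaToFluid Q P).2.tsupport_subset h)
      rw [h1, h2, dot_zero_left, zero_mul, add_zero]

/-! ### The lift is a homomorphism -/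

theorem IsFluid.scBracket {ξ η : FluidPair} (hξ : IsFluid Q ξ) (hη : IsFluid Q η) :
    IsFluid Q (scBracket ξ η) := by
  have hd : ∀ {G : Type} [NormedAddCommGroup G] [NormedSpace ℝ G] {f : E3 → G} {X : E3 → E3},
      ContDiffOn ℝ ∞ f Q → ContDiffOn ℝ ∞ X Q → ContDiffOn ℝ ∞ (fun q => fderiv ℝ f q (X q)) Q :=
    fun hf hX => (hf.fderiv_of_isOpen Q.isOpen (m := ∞) (by simp)).clm_apply hX
  exact ⟨(hd hη.1 hξ.1).sub (hd hξ.1 hη.1), (hd hη.2 hξ.1).sub (hd hξ.2 hη.1)⟩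

section PartialDerivatives

variable {f g : E3 → ℝ} {q : E3}

theorem fderiv_apply_eq_sum_pd (f : E3 → ℝ) (q v : E3) : fderiv ℝ f q v = ∑ j, v j * pd f j q := by
  rw [clm_apply_eq_sum]
  rfl

theorem pd_mul (hf : DifferentiableAt ℝ f q) (hg : DifferentiableAt ℝ g q) (j : Fin 3) :
    pd (fun q => f q * g q) j q = f q * pd g j q + g q * pd f j q := by
  simp only [pd, fderiv_fun_mul hf hg]
  rfl

theorem pd_sub (hf : DifferentiableAt ℝ f q) (hg : DifferentiableAt ℝ g q) (j : Fin 3) :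
    pd (fun q => f q - g q) j q = pd f j q - pd g j q := by
  simp only [pd, fderiv_fun_sub hf hg]
  rfl

theorem pd_sum {ι : Type*} {s : Finset ι} {F : ι → E3 → ℝ}
    (hF : ∀ i ∈ s, DifferentiableAt ℝ (F i) q) (j : Fin 3) :
    pd (fun q => ∑ i ∈ s, F i q) j q = ∑ i ∈ s, pd (F i) j q := by
  simp [pd, (HasFDerivAt.fun_sum fun i hi => (hF i hi).hasFDerivAt).fderiv]

theorem contDiffAt_pd (hf : ContDiffAt ℝ ∞ f q) (j : Fin 3) : ContDiffAt ℝ ∞ (pd f j) q :=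
  (hf.fderiv_right (m := ∞) (by simp)).clm_apply contDiffAt_const

theorem pd_comm (hf : ContDiffAt ℝ ∞ f q) (i j : Fin 3) : pd (pd f i) j q = pd (pd f j) i q := by
  have hd : DifferentiableAt ℝ (fderiv ℝ f) q :=
    (hf.fderiv_right (m := ∞) (by simp)).differentiableAt (by simp)
  have hsymm : IsSymmSndFDerivAt ℝ f q :=
    hf.isSymmSndFDerivAt (by simpa using WithTop.coe_le_coe.2 (le_top : (2 : ℕ∞) ≤ ⊤))
  have h : ∀ i j, pd (pd f i) j q = fderiv ℝ (fderiv ℝ f) q (EuclideanSpace.single j 1)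
      (EuclideanSpace.single i 1) := fun i j => by
    change fderiv ℝ (fun q => fderiv ℝ f q (EuclideanSpace.single i 1)) q _ = _
    rw [fderiv_clm_apply hd (differentiableAt_const _)]
    simp
  rw [h, h, hsymm.eq]

end PartialDerivatives

theorem fderiv_apply_coord {X : E3 → E3} {q : E3} (hX : DifferentiableAt ℝ X q) (v : E3)
    (i : Fin 3) : (fderiv ℝ X q v) i = ∑ j, v j * pd (fun q => X q i) j q := by
  have h : HasFDerivAt (fun q => X q i) ((EuclideanSpace.proj i : E3 →L[ℝ] ℝ).comp (fderiv ℝ X q))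
      q := (EuclideanSpace.proj i : E3 →L[ℝ] ℝ).hasFDerivAt.comp q hX.hasFDerivAt
  rw [← fderiv_apply_eq_sum_pd, h.fderiv]
  rfl

theorem lift_fst (ξ : FluidPair) (z : Z6) : (lift ξ z).1 = ξ.1 z.1 := by
  simp [lift, cotangentLift, momentumTranslation]

theorem lift_snd (ξ : FluidPair) (z : Z6) (j : Fin 3) :
    (lift ξ z).2 j = -(∑ i, z.2 i * pd (fun q => ξ.1 q i) j z.1) - pd ξ.2 j z.1 := by
  simp [lift, cotangentLift, momentumTranslation, grad, sub_eq_add_neg]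

theorem contDiffAt_coord {X : E3 → E3} {q : E3} (hX : ContDiffAt ℝ ∞ X q) (i : Fin 3) :
    ContDiffAt ℝ ∞ (fun q => X q i) q :=
  (EuclideanSpace.proj i : E3 →L[ℝ] ℝ).contDiff.contDiffAt.comp q hX

theorem fderiv_lift_snd {ξ : FluidPair} {z : Z6} (h1 : ContDiffAt ℝ ∞ ξ.1 z.1)
    (h2 : ContDiffAt ℝ ∞ ξ.2 z.1) (hd : DifferentiableAt ℝ (lift ξ) z) (v : Z6) (j : Fin 3) :
    (fderiv ℝ (lift ξ) z v).2 j =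
      -(∑ i, (z.2 i * ∑ k, v.1 k * pd (pd (fun q => ξ.1 q i) j) k z.1 +
        pd (fun q => ξ.1 q i) j z.1 * v.2 i)) - ∑ k, v.1 k * pd (pd ξ.2 j) k z.1 := by
  have hp : ∀ {f : E3 → ℝ}, ContDiffAt ℝ ∞ f z.1 → HasFDerivAt (fun w : Z6 => pd f j w.1)
      ((fderiv ℝ (pd f j) z.1).comp (.fst ℝ E3 E3)) z := fun {f} hf =>
    HasFDerivAt.comp (g := pd f j) z
      ((contDiffAt_pd hf j).differentiableAt (by simp)).hasFDerivAt hasFDerivAt_fst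
  have hz : ∀ i, HasFDerivAt (fun w : Z6 => w.2 i) (pCoord i) z := fun i => (pCoord i).hasFDerivAt
  have h := ((HasFDerivAt.fun_sum (u := Finset.univ) fun i _ =>
    (hz i).mul (hp (contDiffAt_coord h1 i))).neg.sub (hp h2))
  have h' : HasFDerivAt (fun w => pCoord j (lift ξ w)) ((pCoord j).comp (fderiv ℝ (lift ξ) z)) z :=
    (pCoord j).hasFDerivAt.comp z hd.hasFDerivAt
  simp only [pCoord_apply, lift_snd] at h'
  have h3 := DFunLike.congr_fun (h'.unique h) v
  simp only [← fderiv_apply_eq_sum_pd]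
  simpa using h3

theorem liftIsHom (Q : Opens E3) : LiftIsHom Q := by
  intro ξ η hξ hη
  refine ⟨hξ.isHam_lift, hξ.scBracket hη, fun z hz => ?_⟩
  have hQ := Q.isOpen.mem_nhds (mem_phase.1 hz)
  have x1 := hξ.1.contDiffAt hQ
  have x2 := hξ.2.contDiffAt hQ
  have y1 := hη.1.contDiffAt hQ
  have y2 := hη.2.contDiffAt hQ
  have dx := (hξ.isHam_lift.contDiffOn.contDiffAt ((isOpen_phase Q).mem_nhds hz)).differentiableAt
    (by simp)
  have dy := (hη.isHam_lift.contDiffOn.contDiffAt ((isOpen_phase Q).mem_nhds hz)).differentiableAt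
    (by simp)
  have hfst : ∀ {ζ : FluidPair} (v : Z6), DifferentiableAt ℝ ζ.1 z.1 →
      DifferentiableAt ℝ (lift ζ) z → (fderiv ℝ (lift ζ) z v).1 = fderiv ℝ ζ.1 z.1 v.1 := by
    intro ζ v h1 h
    have a : HasFDerivAt (fun w => (lift ζ w).1)
        ((ContinuousLinearMap.fst ℝ E3 E3).comp (fderiv ℝ (lift ζ) z)) z :=
      (ContinuousLinearMap.fst ℝ E3 E3).hasFDerivAt.comp z h.hasFDerivAt
    have b : HasFDerivAt (fun w => (lift ζ w).1)
        ((fderiv ℝ ζ.1 z.1).comp (.fst ℝ E3 E3)) z := by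
      simp only [lift_fst]
      exact HasFDerivAt.comp (g := ζ.1) z h1.hasFDerivAt hasFDerivAt_fst
    exact DFunLike.congr_fun (a.unique b) v
  have diff : ∀ {f : E3 → ℝ}, ContDiffAt ℝ ∞ f z.1 → DifferentiableAt ℝ f z.1 :=
    fun h => h.differentiableAt (by simp)
  refine Prod.ext ?_ ?_
  · rw [lift_fst, VectorField.lieBracket_eq, Prod.fst_sub,
      hfst _ (y1.differentiableAt (by simp)) dy, hfst _ (x1.differentiableAt (by simp)) dx,
      lift_fst, lift_fst]
    rfl
  · ext j
    -- The `p`-component of a lift is affine in `p`, and all its coefficients obey this one rule: it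
    -- is used with `(f, g) = (X^i, Y^i)` for the linear part and `(φ, ζ)` for the constant part.
    have key : ∀ {f g : E3 → ℝ}, ContDiffAt ℝ ∞ f z.1 → ContDiffAt ℝ ∞ g z.1 →
        pd (fun q => (∑ k, ξ.1 q k * pd g k q) - ∑ k, η.1 q k * pd f k q) j z.1 =
        (∑ k, (ξ.1 z.1 k * pd (pd g j) k z.1 + pd g k z.1 * pd (fun q => ξ.1 q k) j z.1)) -
        ∑ k, (η.1 z.1 k * pd (pd f j) k z.1 + pd f k z.1 * pd (fun q => η.1 q k) j z.1) := by
      intro f g hf hg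
      have m1 : ∀ k, ContDiffAt ℝ ∞ (fun q => ξ.1 q k * pd g k q) z.1 := fun k =>
        (contDiffAt_coord x1 k).mul (contDiffAt_pd hg k)
      have m2 : ∀ k, ContDiffAt ℝ ∞ (fun q => η.1 q k * pd f k q) z.1 := fun k =>
        (contDiffAt_coord y1 k).mul (contDiffAt_pd hf k)
      rw [pd_sub (DifferentiableAt.fun_sum fun k _ => diff (m1 k))
          (DifferentiableAt.fun_sum fun k _ => diff (m2 k)),
        pd_sum fun k _ => diff (m1 k), pd_sum fun k _ => diff (m2 k)]
      congr 1
      · refine Finset.sum_congr rfl fun k _ => ?_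
        rw [pd_mul (diff (contDiffAt_coord x1 k)) (diff (contDiffAt_pd hg k)), pd_comm hg]
      · refine Finset.sum_congr rfl fun k _ => ?_
        rw [pd_mul (diff (contDiffAt_coord y1 k)) (diff (contDiffAt_pd hf k)), pd_comm hf]
    have s1 : ∀ i, pd (fun q => (scBracket ξ η).1 q i) j z.1 = pd (fun q =>
        (∑ k, ξ.1 q k * pd (fun q => η.1 q i) k q) - ∑ k, η.1 q k * pd (fun q => ξ.1 q i) k q)
          j z.1 := fun i => by
      refine congrArg (fun L : E3 →L[ℝ] ℝ => L (EuclideanSpace.single j 1))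
        (Filter.EventuallyEq.fderiv_eq ?_)
      -- The coordinate formula for the bracket needs differentiability, so it holds only on `Q`;
      -- that is a neighbourhood, which suffices for derivatives.
      filter_upwards [hQ] with q hq
      rw [← fderiv_apply_coord ((hη.1.contDiffAt (Q.isOpen.mem_nhds hq)).differentiableAt (by simp)),
        ← fderiv_apply_coord ((hξ.1.contDiffAt (Q.isOpen.mem_nhds hq)).differentiableAt (by simp))]
      rfl
    have s2 : pd (scBracket ξ η).2 j z.1 = pd (fun q =>
        (∑ k, ξ.1 q k * pd η.2 k q) - ∑ k, η.1 q k * pd ξ.2 k q) j z.1 := by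
      simp only [← fderiv_apply_eq_sum_pd]
      rfl
    have s3 := fun i => (s1 i).trans (key (contDiffAt_coord x1 i) (contDiffAt_coord y1 i))
    rw [lift_snd, s2, key x2 y2, VectorField.lieBracket_eq, Prod.snd_sub, PiLp.sub_apply,
      fderiv_lift_snd x1 x2 dx, fderiv_lift_snd y1 y2 dy]
    simp only [s3, lift_fst, lift_snd, Fin.sum_univ_three]
    ring

/-! ### Uniqueness of the variational derivative -/

theorem form_add_smul (P R : MomentumForm Q) (ε : ℝ) (z : Z6) :
    form (P + ε • R) z = form P z + ε • form R z := rfl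

/-- The momentum variable `g w` for a test function `g` on phase space and a covector `w`. -/
def testForm {g : Z6 → ℝ} (hg : ContDiff ℝ ∞ g) (hc : HasCompactSupport g)
    (hs : tsupport g ⊆ phase Q) (w : Z6) : MomentumForm Q :=
  ⟨(hc.smul_right (f' := fun _ => w)).toSchwartzMap (hg.smul contDiff_const),
    Prod.fst '' tsupport g, hc.isCompact.image continuous_fst,
    by
      rintro _ ⟨z, hz, rfl⟩
      exact mem_phase.1 (hs hz),
    fun q hq p => by
      have h : g (q, p) = 0 := image_eq_zero_of_notMem_tsupport fun h => hq ⟨_, h, rfl⟩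
      change g (q, p) • w = 0
      rw [h, zero_smul]⟩

theorem form_testForm {g : Z6 → ℝ} (hg : ContDiff ℝ ∞ g) (hc : HasCompactSupport g)
    (hs : tsupport g ⊆ phase Q) (w z : Z6) : form (testForm hg hc hs w) z = g z • w := rfl

/-- The fundamental lemma of the calculus of variations: testing with the forms `g w` makes `w · (X
- Y)` vanish almost everywhere, hence everywhere on `T*Q` by continuity. -/
theorem HasGDeriv.eqOn {K : MomentumForm Q → ℝ} {P : MomentumForm Q} {X Y : Z6 → Z6}
    (hX : HasGDeriv K P X) (hY : HasGDeriv K P Y) : EqOn X Y (phase Q) := by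
  have hc : ∀ w, ContinuousOn (fun z => pairCLM w (X z - Y z)) (phase Q) := fun w =>
    (pairCLM w).continuous.comp_continuousOn
      (hX.1.contDiffOn.continuousOn.sub hY.1.contDiffOn.continuousOn)
  have key : ∀ w, EqOn (fun z => pairCLM w (X z - Y z)) (fun _ => 0) (phase Q) := fun w => by
    refine Measure.eqOn_open_of_ae_eq (μ := volume) ?_ (isOpen_phase Q) (hc w) continuousOn_const
    refine (ae_restrict_iff' (isOpen_phase Q).measurableSet).2 ?_
    refine (isOpen_phase Q).ae_eq_zero_of_integral_contDiff_smul_eq_zero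
      ((hc w).locallyIntegrableOn (isOpen_phase Q).measurableSet) fun g hg hgc hgs => ?_
    have h1 := hX.2 (testForm hg hgc hgs w)
    have h2 := hY.2 (testForm hg hgc hgs w)
    have h3 := h1.2.unique h2.2
    rw [← sub_eq_zero, ← integral_sub h1.1 h2.1] at h3
    rw [← setIntegral_eq_integral_of_forall_compl_eq_zero (s := phase Q), ← h3]
    · refine integral_congr_ae (.of_forall fun z => ?_)
      simp [form_testForm, pair_eq_pairCLM, mul_sub]
    · intro z hz
      rw [image_eq_zero_of_notMem_tsupport fun h => hz (hgs h), zero_smul]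
  intro z hz
  rw [← sub_eq_zero]
  -- Choosing the covector `w = X z - Y z` yields a sum of two squared norms equal to zero.
  have h := key (X z - Y z) hz
  simp only [pairCLM, add_apply, ContinuousLinearMap.bilinearComp_apply,
    innerSL_apply_apply, real_inner_self_eq_norm_sq, ContinuousLinearMap.coe_fst',
    ContinuousLinearMap.coe_snd'] at h
  have h1 := sq_nonneg ‖(X z - Y z).1‖
  have h2 := sq_nonneg ‖(X z - Y z).2‖
  refine Prod.ext ?_ ?_
  · exact norm_eq_zero.1 (pow_eq_zero_iff two_ne_zero |>.1 (by linarith))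
  · exact norm_eq_zero.1 (pow_eq_zero_iff two_ne_zero |>.1 (by linarith))

theorem HasGDeriv.gDeriv {K : MomentumForm Q → ℝ} {P : MomentumForm Q} {X : Z6 → Z6}
    (hX : HasGDeriv K P X) : HasGDeriv K P (gDeriv K P) := by
  have h : ∃ X, HasGDeriv K P X := ⟨X, hX⟩
  rw [PlasmaFluid.gDeriv, dif_pos h]
  exact h.choose_spec

theorem gBracket_congr {X X' Y Y' : Z6 → Z6} (hX : EqOn X X' (phase Q)) (hY : EqOn Y Y' (phase Q)) :
    EqOn (gBracket X Y) (gBracket X' Y') (phase Q) := by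
  intro z hz
  have h1 : X =ᶠ[nhds z] X' := hX.eventuallyEq_of_mem ((isOpen_phase Q).mem_nhds hz)
  have h2 : Y =ᶠ[nhds z] Y' := hY.eventuallyEq_of_mem ((isOpen_phase Q).mem_nhds hz)
  simp only [gBracket, h1.lieBracket_vectorField_eq h2]

/-- Lets any known representative of the derivative stand in for the one picked by choice. -/
theorem lpIntegrand_eqOn {K H : MomentumForm Q → ℝ} {P : MomentumForm Q} {X Y : Z6 → Z6}
    (hX : HasGDeriv K P X) (hY : HasGDeriv H P Y) :
    EqOn (lpIntegrand K H P) (fun z => pair (form P z) (gBracket X Y z)) (phase Q) := by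
  intro z hz
  simp only [lpIntegrand, gBracket_congr (hX.gDeriv.eqOn hX) (hY.gDeriv.eqOn hY) hz]

/-! ### The Poisson property -/

theorem pair_add_left (a b v : Z6) : pair (a + b) v = pair a v + pair b v := by
  simp [pair_eq_pairCLM]

theorem pair_smul_left (c : ℝ) (a v : Z6) : pair (c • a) v = c * pair a v := by
  simp [pair_eq_pairCLM]

theorem pair_neg_right (a v : Z6) : pair a (-v) = -pair a v := by
  simp [pair_eq_pairCLM]

theorem hasGDeriv_comp_plasmaToFluid {F : FluidDual Q → ℝ} {P : MomentumForm Q} {ξ : FluidPair}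
    (hF : HasFluidDeriv F (plasmaToFluid Q P) ξ) :
    HasGDeriv (F ∘ plasmaToFluid Q) P (lift ξ) := by
  refine ⟨hF.1.isHam_lift, fun R => ?_⟩
  obtain ⟨h1, h2⟩ := isDualOfLift_plasmaToFluid R ξ hF.1
  refine ⟨h1, ?_⟩
  have h := hF.2 (plasmaToFluid Q R)
  rw [h2] at h
  simpa using h

theorem HasFluidDeriv.fluidDeriv {F : FluidDual Q → ℝ} {m : FluidDual Q} {ξ : FluidPair}
    (hF : HasFluidDeriv F m ξ) : HasFluidDeriv F m (fluidDeriv F m) := by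
  have h : ∃ ξ, HasFluidDeriv F m ξ := ⟨ξ, hF⟩
  rw [PlasmaFluid.fluidDeriv, dif_pos h]
  exact h.choose_spec

theorem integrableOn_of_testFunction {G : Type*} [NormedAddCommGroup G]
    [NormedSpace ℝ G] (m : 𝓓(Q, G)) {f : E3 → ℝ} (hf : ContinuousOn f Q)
    (h0 : ∀ q, m q = 0 → f q = 0) : IntegrableOn f Q := by
  have hs : IntegrableOn f (tsupport m) :=
    (hf.mono m.tsupport_subset).integrableOn_compact m.hasCompactSupport
  refine hs.of_forall_sdiff_eq_zero Q.isOpen.measurableSet fun q hq => ?_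
  exact h0 q (image_eq_zero_of_notMem_tsupport hq.2)

theorem dot_apply_grad (f : E3 → ℝ) (q v : E3) : dot v (grad f q) = fderiv ℝ f q v := by
  rw [fderiv_apply_eq_sum_pd]
  rfl

theorem isPoissonMap_plasmaToFluid : IsPoissonMap (plasmaToFluid Q) := by
  intro P F G ξ η hF hG
  refine ⟨hasGDeriv_comp_plasmaToFluid hF, hasGDeriv_comp_plasmaToFluid hG, ?_⟩
  -- Lifting the very representatives that occur in `fluidBracket` avoids a uniqueness statement on
  -- the fluid side.
  set ξ' := fluidDeriv F (plasmaToFluid Q P) with hξ'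
  set η' := fluidDeriv G (plasmaToFluid Q P) with hη'
  have hF' : HasFluidDeriv F (plasmaToFluid Q P) ξ' := hF.fluidDeriv
  have hG' : HasFluidDeriv G (plasmaToFluid Q P) η' := hG.fluidDeriv
  have hb : IsFluid Q (scBracket ξ' η') := hF'.1.scBracket hG'.1
  obtain ⟨d1, d2⟩ := isDualOfLift_plasmaToFluid P _ hb
  have e : EqOn (lpIntegrand (F ∘ plasmaToFluid Q) (G ∘ plasmaToFluid Q) P)
      (fun z => -pair (form P z) (lift (scBracket ξ' η') z)) (phase Q) := fun z hz => by
    rw [lpIntegrand_eqOn (hasGDeriv_comp_plasmaToFluid hF') (hasGDeriv_comp_plasmaToFluid hG') hz]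
    beta_reduce
    rw [(liftIsHom Q ξ' η' hF'.1 hG'.1).2.2 hz, ← pair_neg_right]
    rfl
  have hm := (isOpen_phase Q).measurableSet
  -- The bracket is now minus the pairing of `Φ(Π)` with `[ξ', η']`. The remaining integrability
  -- goals justify splitting it into the `M` and `ρ` integrals.
  refine ⟨d1.neg.congr_fun e.symm hm, ?_⟩
  rw [lpBracket, setIntegral_congr_fun hm e, integral_neg, ← d2, fluidPairing, fluidBracket,
    ← hξ', ← hη', ← integral_neg, ← integral_add]
  · refine integral_congr_ae (.of_forall fun q => ?_)
    simp only [dot_apply_grad, scBracket]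
    simp only [dot_eq_inner, map_neg]
    ring
  · refine integrableOn_of_testFunction (plasmaToFluid Q P).2 ?_ fun q hq => by
      rw [hq, dot_zero_left]
    simp only [dot_eq_inner, innerSL_apply_apply]
    exact (plasmaToFluid Q P).2.continuous.continuousOn.inner (𝕜 := ℝ) hb.1.continuousOn.neg
  · refine integrableOn_of_testFunction (plasmaToFluid Q P).1 ?_ fun q hq => by
      rw [hq, zero_mul]
    simp only [dot_apply_grad]
    refine (plasmaToFluid Q P).1.continuous.continuousOn.mul ?_
    exact (hb.2.continuousOn.neg).congr fun q _ => by simp [scBracket]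

/-! ### Hamiltonian vector fields preserve the Liouville measure -/

/-- Moving the derivative off `h` turns either side into `-∫ h ∂_u ∂_v g`, which is symmetric in `u`
and `v`. -/
theorem integral_fderiv_mul_fderiv_comm {g h : Z6 → ℝ} (hg : ContDiff ℝ ∞ g)
    (hc : HasCompactSupport g) (hh : ContDiff ℝ ∞ h) (u v : Z6) :
    ∫ z, fderiv ℝ h z v * fderiv ℝ g z u = ∫ z, fderiv ℝ h z u * fderiv ℝ g z v := by
  have hg' : ContDiff ℝ ∞ (fderiv ℝ g) := (contDiff_infty_iff_fderiv.1 hg).2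
  have hh' : ContDiff ℝ ∞ (fderiv ℝ h) := (contDiff_infty_iff_fderiv.1 hh).2
  have hgu : ∀ u, ContDiff ℝ ∞ fun z => fderiv ℝ g z u := fun u => hg'.clm_apply contDiff_const
  have hhu : ∀ u, ContDiff ℝ ∞ fun z => fderiv ℝ h z u := fun u => hh'.clm_apply contDiff_const
  have cu : ∀ u, HasCompactSupport fun z => fderiv ℝ g z u := fun u => hc.fderiv_apply (𝕜 := ℝ) u
  have hguv : ∀ u, ContDiff ℝ ∞ (fderiv ℝ fun z => fderiv ℝ g z u) := fun u =>
    (contDiff_infty_iff_fderiv.1 (hgu u)).2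
  have key : ∀ u v, ∫ z, h z * fderiv ℝ (fun z => fderiv ℝ g z u) z v =
      -∫ z, fderiv ℝ h z v * fderiv ℝ g z u := fun u v =>
    integral_mul_fderiv_eq_neg_fderiv_mul_of_integrable
      (((hhu v).continuous.mul (hgu u).continuous).integrable_of_hasCompactSupport
        (cu u).mul_left)
      ((hh.continuous.mul ((hguv u).clm_apply contDiff_const).continuous
        ).integrable_of_hasCompactSupport ((cu u).fderiv_apply (𝕜 := ℝ) v).mul_left)
      ((hh.continuous.mul (hgu u).continuous).integrable_of_hasCompactSupport (cu u).mul_left)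
      (fun z _ => hh.differentiable (by simp) z) fun z _ => (hgu u).differentiable (by simp) z
  have hsymm : ∀ z, fderiv ℝ (fun z => fderiv ℝ g z u) z v =
      fderiv ℝ (fun z => fderiv ℝ g z v) z u := fun z => by
    have hd : DifferentiableAt ℝ (fderiv ℝ g) z := hg'.differentiable (by simp) z
    rw [fderiv_clm_apply hd (differentiableAt_const _),
      fderiv_clm_apply hd (differentiableAt_const _)]
    have hs : IsSymmSndFDerivAt ℝ g z := hg.contDiffAt.isSymmSndFDerivAt
      (by simpa using WithTop.coe_le_coe.2 (le_top : (2 : ℕ∞) ≤ ⊤))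
    simpa using hs.eq v u
  have h1 := key u v
  simp only [hsymm, key v u] at h1
  exact (neg_injective h1).symm

theorem integral_fderiv_lift_eq_zero_of_hasCompactSupport {ξ : FluidPair} (hξ : IsFluidTest ξ)
    {g : Z6 → ℝ} (hg : ContDiff ℝ ∞ g) (hc : HasCompactSupport g) :
    ∫ z, fderiv ℝ g z (lift ξ z) = 0 := by
  have hh : ContDiff ℝ ∞ (liftHam ξ) := hξ.hasTemperateGrowth_liftHam.1
  have hi : ∀ u v, Integrable fun z => fderiv ℝ (liftHam ξ) z v * fderiv ℝ g z u := fun u v =>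
    (((hh.continuous_fderiv (by simp)).clm_apply continuous_const).mul
      ((hg.continuous_fderiv (by simp)).clm_apply continuous_const)).integrable_of_hasCompactSupport
        (hc.fderiv_apply (𝕜 := ℝ) u).mul_left
  have e : ∀ z, fderiv ℝ g z (lift ξ z) =
      ∑ j, (fderiv ℝ (liftHam ξ) z (pDir j) * fderiv ℝ g z (qDir j) -
        fderiv ℝ (liftHam ξ) z (qDir j) * fderiv ℝ g z (pDir j)) := fun z => by
    rw [hξ.lift_eq_sharp]
    simp [sharp]
  simp only [e]
  refine (integral_finsetSum _ fun j _ => (hi (qDir j) (pDir j)).sub (hi (pDir j) (qDir j))).trans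
    (Finset.sum_eq_zero fun j _ => ?_)
  simp only [Pi.sub_apply]
  rw [integral_sub (hi _ _) (hi _ _), integral_fderiv_mul_fderiv_comm hg hc hh, sub_self]

theorem norm_le_sum_abs (v : E3) : ‖v‖ ≤ ∑ j, |v j| := by
  conv_lhs => rw [← sum_smul_single v]
  refine (norm_sum_le _ _).trans (Finset.sum_le_sum fun j _ => ?_)
  simp [norm_smul]

/-- The momentum component of a lift grows at most linearly in the momenta. -/
theorem IsFluidTest.exists_norm_lift_snd_le {ξ : FluidPair} (hξ : IsFluidTest ξ) :
    ∃ C, 0 ≤ C ∧ ∀ z, ‖(lift ξ z).2‖ ≤ C * (1 + ‖z.2‖) := by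
  obtain ⟨A, hA⟩ := (hξ.contDiff_fst.continuous_fderiv (by simp)).bounded_above_of_compact_support
    (hξ.hasCompactSupport_fst.fderiv (𝕜 := ℝ))
  obtain ⟨B, hB⟩ := (hξ.contDiff_snd.continuous_fderiv (by simp)).bounded_above_of_compact_support
    (hξ.hasCompactSupport_snd.fderiv (𝕜 := ℝ))
  have hA0 : 0 ≤ A := (norm_nonneg _).trans (hA 0)
  have hB0 : 0 ≤ B := (norm_nonneg _).trans (hB 0)
  -- `A` and `B` bound the derivatives of `X` and `φ`; the factor `3` comes from summing over the
  -- coordinates.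
  refine ⟨3 * (A + B), by positivity, fun z => ?_⟩
  have h : ∀ j, |(lift ξ z).2 j| ≤ (A + B) * (1 + ‖z.2‖) := fun j => by
    have e : (lift ξ z).2 j = -(inner ℝ z.2 (fderiv ℝ ξ.1 z.1 (EuclideanSpace.single j 1)) +
        fderiv ℝ ξ.2 z.1 (EuclideanSpace.single j 1)) := by
      rw [lift_snd, ← innerSL_apply_apply ℝ, ← dot_eq_inner, dot]
      simp only [fderiv_apply_coord (hξ.contDiff_fst.differentiable (by simp) z.1),
        fderiv_apply_eq_sum_pd]
      simp
      ring
    have h1 : ‖fderiv ℝ ξ.1 z.1 (EuclideanSpace.single j 1)‖ ≤ A := by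
      refine ((fderiv ℝ ξ.1 z.1).le_opNorm _).trans ?_
      simpa using hA z.1
    have h2 : |fderiv ℝ ξ.2 z.1 (EuclideanSpace.single j 1)| ≤ B := by
      refine ((fderiv ℝ ξ.2 z.1).le_opNorm _).trans ?_
      simpa using hB z.1
    rw [e, abs_neg]
    calc _ ≤ ‖z.2‖ * A + B := (abs_add_le _ _).trans
          (add_le_add ((abs_real_inner_le_norm _ _).trans
            (mul_le_mul_of_nonneg_left h1 (norm_nonneg _))) h2)
      _ ≤ (A + B) * (1 + ‖z.2‖) := by nlinarith [norm_nonneg z.2]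
  refine (norm_le_sum_abs _).trans ((Finset.sum_le_sum fun j _ => h j).trans_eq ?_)
  simp
  ring

/-- The flow of a lift preserves the Liouville measure: `∫ X(f) dμ = 0` for integrable `f`, with
integrable `X(f)`, whose support projects into a compact set of positions. -/
theorem integral_fderiv_lift_eq_zero {ξ : FluidPair} (hξ : IsFluidTest ξ) {f : Z6 → ℝ}
    {K : Set E3} (hK : IsCompact K) (hf : ContDiff ℝ ∞ f) (hfK : ∀ q ∉ K, ∀ p, f (q, p) = 0)
    (hi : Integrable f) (hi' : Integrable fun z => fderiv ℝ f z (lift ξ z)) :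
    ∫ z, fderiv ℝ f z (lift ξ z) = 0 := by
  let χ : ContDiffBump (0 : E3) := ⟨1, 2, one_pos, one_lt_two⟩
  have hχ : ContDiff ℝ ∞ χ := χ.contDiff
  let a : ℕ → ℝ := fun n => ((n : ℝ) + 1)⁻¹
  have ha0 : ∀ n, 0 < a n := fun n => by positivity
  have ha1 : ∀ n, a n ≤ 1 := fun n => inv_le_one_of_one_le₀ (by simp)
  have ha : Filter.Tendsto a Filter.atTop (nhds 0) := by
    simpa [a] using tendsto_one_div_add_atTop_nhds_zero_nat (𝕜 := ℝ)
  -- A cutoff in the momenta alone suffices, because `f` is already supported over `K`.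
  let θ : ℕ → Z6 → ℝ := fun n z => χ (a n • z.2)
  have hθ : ∀ n, ContDiff ℝ ∞ (θ n) := fun n => hχ.comp (contDiff_snd.const_smul (a n))
  have hθ' : ∀ n z v, fderiv ℝ (θ n) z v = a n * fderiv ℝ χ (a n • z.2) v.2 := fun n z v => by
    have h : HasFDerivAt (θ n) ((fderiv ℝ χ (a n • z.2)).comp (a n • .snd ℝ E3 E3)) z :=
      HasFDerivAt.comp (g := χ) z (hχ.differentiable (by simp) _).hasFDerivAt
        (hasFDerivAt_snd.const_smul (a n))
    rw [h.fderiv]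
    simp
  obtain ⟨D, hD⟩ : ∃ D, ∀ y : E3, ‖(1 + ‖y‖) • fderiv ℝ χ y‖ ≤ D :=
    ((continuous_const.add continuous_norm).smul (hχ.continuous_fderiv (by simp))
      ).bounded_above_of_compact_support ((χ.hasCompactSupport.fderiv (𝕜 := ℝ)).smul_left)
  have hD' : ∀ y : E3, (1 + ‖y‖) * ‖fderiv ℝ χ y‖ ≤ D := fun y => by
    have h := hD y
    rwa [norm_smul, Real.norm_of_nonneg (by positivity)] at h
  have hD1 : ∀ y : E3, ‖fderiv ℝ χ y‖ ≤ D := fun y =>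
    (le_mul_of_one_le_left (norm_nonneg _) (by simp)).trans (hD' y)
  obtain ⟨C, hC0, hC⟩ := hξ.exists_norm_lift_snd_le
  -- The derivative of the cutoff brings a factor `a n`, which absorbs the linear growth of the
  -- lift: `a n (1 + ‖p‖) ≤ 1 + ‖a n p‖` as `a n ≤ 1`, and `(1 + ‖y‖) ‖χ'(y)‖ ≤ D`. The bound is
  -- uniform in `n`, so integrability of `f` dominates the error term.
  have hb : ∀ n z, |fderiv ℝ (θ n) z (lift ξ z)| ≤ D * C := fun n z => by
    rw [hθ', abs_mul, abs_of_pos (ha0 n)]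
    have h1 : |fderiv ℝ χ (a n • z.2) (lift ξ z).2| ≤
        ‖fderiv ℝ χ (a n • z.2)‖ * (C * (1 + ‖z.2‖)) :=
      ((fderiv ℝ χ (a n • z.2)).le_opNorm _).trans
        (mul_le_mul_of_nonneg_left (hC z) (norm_nonneg _))
    have h2 : a n * (1 + ‖z.2‖) ≤ 1 + ‖a n • z.2‖ := by
      rw [norm_smul, Real.norm_of_nonneg (ha0 n).le]
      linarith [ha1 n]
    calc _ ≤ a n * (‖fderiv ℝ χ (a n • z.2)‖ * (C * (1 + ‖z.2‖))) :=
          mul_le_mul_of_nonneg_left h1 (ha0 n).le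
      _ = (a n * (1 + ‖z.2‖)) * ‖fderiv ℝ χ (a n • z.2)‖ * C := by ring
      _ ≤ ((1 + ‖a n • z.2‖) * ‖fderiv ℝ χ (a n • z.2)‖) * C := by gcongr
      _ ≤ D * C := by gcongr; exact hD' _
  have hl : ∀ z, Filter.Tendsto (fun n => fderiv ℝ (θ n) z (lift ξ z)) Filter.atTop (nhds 0) := by
    intro z
    refine squeeze_zero_norm (a := fun n => a n * (D * ‖(lift ξ z).2‖)) (fun n => ?_)
      (by simpa using ha.mul_const (D * ‖(lift ξ z).2‖))
    rw [hθ', norm_mul, Real.norm_of_nonneg (ha0 n).le]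
    exact mul_le_mul_of_nonneg_left (((fderiv ℝ χ (a n • z.2)).le_opNorm _).trans
      (mul_le_mul_of_nonneg_right (hD1 _) (norm_nonneg _))) (ha0 n).le
  have hθ1 : ∀ z, Filter.Tendsto (fun n => θ n z) Filter.atTop (nhds 1) := fun z => by
    have h : Filter.Tendsto (fun n => a n • z.2) Filter.atTop (nhds 0) := by
      simpa using ha.smul_const z.2
    have h0 : χ 0 = 1 := χ.one_of_mem_closedBall (by simp [χ])
    rw [← h0]
    exact (hχ.continuous.tendsto 0).comp h
  have hfd : Differentiable ℝ f := hf.differentiable (by simp)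
  have hprod : ∀ n z, fderiv ℝ (fun z => θ n z * f z) z (lift ξ z) =
      θ n z * fderiv ℝ f z (lift ξ z) + f z * fderiv ℝ (θ n) z (lift ξ z) := fun n z => by
    rw [fderiv_fun_mul ((hθ n).differentiable (by simp) z) (hfd z)]
    rfl
  have hzero : ∀ n, ∫ z, (θ n z * fderiv ℝ f z (lift ξ z) +
      f z * fderiv ℝ (θ n) z (lift ξ z)) = 0 := fun n => by
    simp only [← hprod]
    refine integral_fderiv_lift_eq_zero_of_hasCompactSupport hξ ((hθ n).mul hf) ?_
    refine HasCompactSupport.intro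
      (hK.prod (isCompact_closedBall (0 : E3) (2 * (n + 1)))) fun z hz => ?_
    by_cases hq : z.1 ∈ K
    · have hp : 2 * ((n : ℝ) + 1) < ‖z.2‖ := by
        by_contra hcon
        exact hz ⟨hq, by simpa using not_lt.1 hcon⟩
      have h0 : θ n z = 0 := χ.zero_of_le_dist (by
        rw [dist_zero_right, norm_smul, Real.norm_of_nonneg (ha0 n).le]
        change (2 : ℝ) ≤ ((n : ℝ) + 1)⁻¹ * ‖z.2‖
        rw [← div_eq_inv_mul, le_div_iff₀ (by positivity)]
        exact hp.le)
      rw [h0, zero_mul]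
    · rw [show f z = 0 from hfK z.1 hq z.2, mul_zero]
  have hlc : Continuous (lift ξ) := hξ.hasTemperateGrowth_lift.1.continuous
  have hlim := tendsto_integral_of_dominated_convergence (μ := (volume : Measure Z6))
    (F := fun n z => θ n z * fderiv ℝ f z (lift ξ z) + f z * fderiv ℝ (θ n) z (lift ξ z))
    (f := fun z => fderiv ℝ f z (lift ξ z))
    (fun z => ‖fderiv ℝ f z (lift ξ z)‖ + ‖f z‖ * (D * C))
    (fun n => (((hθ n).continuous.mul ((hf.continuous_fderiv (by simp)).clm_apply hlc)).add
      (hf.continuous.mul (((hθ n).continuous_fderiv (by simp)).clm_apply hlc))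
        ).aestronglyMeasurable)
    (hi'.norm.add (hi.norm.mul_const _))
    (fun n => .of_forall fun z => by
      refine (norm_add_le _ _).trans (add_le_add ?_ ?_)
      · rw [norm_mul]
        refine mul_le_of_le_one_left (norm_nonneg _) ?_
        rw [Real.norm_of_nonneg χ.nonneg]
        exact χ.le_one
      · rw [norm_mul]
        exact mul_le_mul_of_nonneg_left (hb n z) (norm_nonneg _))
    (.of_forall fun z => by
      simpa using ((hθ1 z).mul_const (fderiv ℝ f z (lift ξ z))).add ((hl z).const_mul (f z)))
  simp only [hzero] at hlim
  exact (tendsto_nhds_unique tendsto_const_nhds hlim).symm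

/-! ### The coadjoint action and the momentum map -/

theorem IsFluidTest.hasTemperateGrowth_fderiv_lift {ξ : FluidPair} (hξ : IsFluidTest ξ) (v : Z6) :
    (fun z => fderiv ℝ (lift ξ) z v).HasTemperateGrowth :=
  (ContinuousLinearMap.apply ℝ Z6 v).hasTemperateGrowth.comp
    (hasTemperateGrowth_fderiv hξ.hasTemperateGrowth_lift)

/-- The Lie derivative `L_X Π` along the lift `X` of a compactly supported fluid pair, as a
Schwartz one-form. -/
def lieDerivSchwartz {ξ : FluidPair} (hξ : IsFluidTest ξ) (P : 𝓢(Z6, Z6)) : 𝓢(Z6, Z6) :=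
  SchwartzMap.bilinLeftCLM (ContinuousLinearMap.id ℝ (Z6 →L[ℝ] Z6)) hξ.hasTemperateGrowth_lift
      (SchwartzMap.fderivCLM ℝ Z6 Z6 P) +
    ∑ j, ((pairSchwartz (hξ.hasTemperateGrowth_fderiv_lift (qDir j)) P).postcompCLM
        (ContinuousLinearMap.toSpanSingleton ℝ (qDir j)) +
      (pairSchwartz (hξ.hasTemperateGrowth_fderiv_lift (pDir j)) P).postcompCLM
        (ContinuousLinearMap.toSpanSingleton ℝ (pDir j)))

theorem lieDerivSchwartz_apply {ξ : FluidPair} (hξ : IsFluidTest ξ) (P : 𝓢(Z6, Z6)) (z : Z6) :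
    lieDerivSchwartz hξ P z = fderiv ℝ P z (lift ξ z) +
      ∑ j, (pair (P z) (fderiv ℝ (lift ξ) z (qDir j)) • qDir j +
        pair (P z) (fderiv ℝ (lift ξ) z (pDir j)) • pDir j) := by
  simp only [lieDerivSchwartz, add_apply, sum_apply, SchwartzMap.postcompCLM_apply,
    pairSchwartz_apply, ContinuousLinearMap.toSpanSingleton_apply]
  rfl

theorem pair_qDir (j : Fin 3) (v : Z6) : pair (qDir j) v = v.1 j := by
  simp [pair, dot, qDir]

theorem pair_pDir (j : Fin 3) (v : Z6) : pair (pDir j) v = v.2 j := by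
  simp [pair, dot, pDir]

theorem pair_lieDerivSchwartz {ξ : FluidPair} (hξ : IsFluidTest ξ) (P : 𝓢(Z6, Z6)) (z v : Z6) :
    pair (lieDerivSchwartz hξ P z) v = lieDerivForm (lift ξ) P z v := by
  have h := clm_apply_eq_sum_dir ((pairCLM (P z)).comp (fderiv ℝ (lift ξ) z)) v
  simp only [ContinuousLinearMap.comp_apply, ← pair_eq_pairCLM, smul_eq_mul] at h
  have hs : ∀ w : Fin 3 → Z6, pair (∑ j, w j) v = ∑ j, pair (w j) v := fun w => by
    simp [pair_eq_pairCLM]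
  rw [lieDerivForm, lieDerivSchwartz_apply, pair_add_left, hs, h]
  simp only [pair_add_left, pair_smul_left, pair_qDir, pair_pDir, mul_comm]

theorem lieDerivForm_congr {X Y π : Z6 → Z6} {z : Z6} (h : X =ᶠ[nhds z] Y) (v : Z6) :
    lieDerivForm X π z v = lieDerivForm Y π z v := by
  rw [lieDerivForm, lieDerivForm, h.eq_of_nhds, h.fderiv_eq]

/-- The generator `-L_X Π` of the action of `ξ ∈ 𝔰`, where `X` is the lift of `ξ`. -/
theorem exists_generator {ξ : FluidPair} (hξ : IsFluid Q ξ) (P : MomentumForm Q) :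
    ∃ V : MomentumForm Q, ∀ z ∈ phase Q, ∀ v : Z6,
      pair (form V z) v = -lieDerivForm (lift ξ) (form P) z v := by
  obtain ⟨K, η, hK, hKQ, hP, hη, hηξ⟩ := exists_test_of_form P hξ
  have h0 : ∀ q ∉ K, ∀ p, lieDerivSchwartz hη P (q, p) = 0 := fun q hq p => by
    have h1 : (P : 𝓢(Z6, Z6)) (q, p) = 0 := hP q hq p
    have h2 : fderiv ℝ (P : 𝓢(Z6, Z6)) (q, p) = 0 :=
      fderiv_eq_zero_of_notMem hK hP (z := (q, p)) hq
    rw [lieDerivSchwartz_apply, h1, h2]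
    simp [pair_zero_left]
  refine ⟨⟨-lieDerivSchwartz hη P, K, hK, hKQ, fun q hq p => ?_⟩, fun z hz v => ?_⟩
  · rw [neg_apply, h0 q hq p, neg_zero]
  · change pair (-lieDerivSchwartz hη P z) v = _
    rw [← neg_one_smul ℝ, pair_smul_left, pair_lieDerivSchwartz, neg_one_mul]
    congr 1
    by_cases hq : z.1 ∈ K
    · exact lieDerivForm_congr (lift_congr (hηξ z.1 hq).1 (hηξ z.1 hq).2) v
    · have h1 : form P z = 0 := hP z.1 hq z.2
      have h2 : fderiv ℝ (form P) z = 0 := fderiv_eq_zero_of_notMem hK hP hq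
      change lieDerivForm (lift η) (form P) z v = _
      simp [lieDerivForm, h1, h2, pair_zero_left]

theorem hasGDeriv_fluidPairing {ξ : FluidPair} (hξ : IsFluid Q ξ) (P : MomentumForm Q) :
    HasGDeriv (fun R => fluidPairing (plasmaToFluid Q R) ξ) P (lift ξ) := by
  refine ⟨hξ.isHam_lift, fun R => ?_⟩
  have p1 := (isDualOfLift_plasmaToFluid P ξ hξ).1
  have r1 := (isDualOfLift_plasmaToFluid R ξ hξ).1
  refine ⟨r1, ?_⟩
  have e : (fun ε : ℝ => fluidPairing (plasmaToFluid Q (P + ε • R)) ξ) = fun ε =>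
      (∫ z in phase Q, pair (form P z) (lift ξ z)) +
        ε * ∫ z in phase Q, pair (form R z) (lift ξ z) := by
    ext ε
    rw [(isDualOfLift_plasmaToFluid (P + ε • R) ξ hξ).2, ← integral_const_mul,
      ← integral_add p1 (r1.const_mul ε)]
    simp only [form_add_smul, pair_add_left, pair_smul_left]
  rw [e]
  simpa only [id, one_mul] using ((hasDerivAt_id (0 : ℝ)).mul_const
    (∫ z in phase Q, pair (form R z) (lift ξ z))).const_add
      (∫ z in phase Q, pair (form P z) (lift ξ z))

/-- The Leibniz rule `X(Π · Y) = (L_X Π) · Y + Π · [X, Y]`. -/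
theorem fderiv_pair_apply {X Y π : Z6 → Z6} {z : Z6} (hY : DifferentiableAt ℝ Y z)
    (hπ : DifferentiableAt ℝ π z) :
    fderiv ℝ (fun z => pair (π z) (Y z)) z (X z) =
      lieDerivForm X π z (Y z) + pair (π z) (VectorField.lieBracket ℝ X Y z) := by
  have h := pairCLM.hasFDerivAt_of_bilinear hπ.hasFDerivAt hY.hasFDerivAt
  simp only [pair_eq_pairCLM, lieDerivForm, VectorField.lieBracket_eq]
  rw [h.fderiv]
  simp
  ring

theorem contDiff_pair_form (P : MomentumForm Q) {Y : Z6 → Z6} (hY : ContDiffOn ℝ ∞ Y (phase Q)) :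
    ContDiff ℝ ∞ fun z => pair (form P z) (Y z) := by
  obtain ⟨K, hK, hKQ, hP⟩ := P.2
  refine contDiff_iff_contDiffAt.2 fun z => ?_
  by_cases hz : z ∈ phase Q
  · simp only [pair_eq_pairCLM]
    exact (pairCLM.contDiff.contDiffAt.comp z ((P : 𝓢(Z6, Z6)).smooth ⊤).contDiffAt).clm_apply
      (hY.contDiffAt ((isOpen_phase Q).mem_nhds hz))
  · refine (contDiffAt_const (c := (0 : ℝ))).congr_of_eventuallyEq ?_
    filter_upwards [eventuallyEq_zero_of_notMem (f := form P) hK hP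
      fun h => hz (mem_phase.2 (hKQ h))] with w hw
    rw [hw, Pi.zero_apply, pair_zero_left]

theorem isMomentumMap_plasmaToFluid : IsMomentumMap (plasmaToFluid Q) := by
  intro ξ hξ
  choose V hV using exists_generator (Q := Q) hξ
  refine ⟨V, hV, fun P => ⟨hasGDeriv_fluidPairing hξ P, ?_⟩⟩
  rintro K ⟨Y, hY⟩ hint
  have hm := (isOpen_phase Q).measurableSet
  have hlp := lpIntegrand_eqOn hY (hasGDeriv_fluidPairing hξ P)
  obtain ⟨v1, v2⟩ := hY.2 (V P)
  -- The derivative of `K` along `V P` is `∫ V(Π) · Y`, so it remains to identify this integral with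
  -- the bracket.
  convert v2 using 1
  obtain ⟨L, η, hL, hLQ, hP, hη, hηξ⟩ := exists_test_of_form P hξ
  have hYd := hY.1.contDiffOn
  have hf := contDiff_pair_form P hYd
  have hf0 : ∀ q ∉ L, ∀ p, pair (form P (q, p)) (Y (q, p)) = 0 := fun q hq p => by
    rw [hP q hq p, pair_zero_left]
  have leibniz : EqOn (fun z => fderiv ℝ (fun z => pair (form P z) (Y z)) z (lift η z))
      (fun z => lpIntegrand K (fun R => fluidPairing (plasmaToFluid Q R) ξ) P z -
        pair (form (V P) z) (Y z)) (phase Q) := fun z hz => by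
    have hYz := (hYd.contDiffAt ((isOpen_phase Q).mem_nhds hz)).differentiableAt (by simp)
    have hPz : DifferentiableAt ℝ (form P) z := (P : 𝓢(Z6, Z6)).differentiableAt
    -- Replacing `ξ` by `η` is harmless: they agree near points of `L`, and off `L` the derivative
    -- of `Π · Y` vanishes.
    have e : fderiv ℝ (fun z => pair (form P z) (Y z)) z (lift η z) =
        fderiv ℝ (fun z => pair (form P z) (Y z)) z (lift ξ z) := by
      by_cases hq : z.1 ∈ L
      · rw [(lift_congr (hηξ z.1 hq).1 (hηξ z.1 hq).2).eq_of_nhds]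
      · rw [fderiv_eq_zero_of_notMem hL hf0 hq]
        rfl
    beta_reduce
    rw [e, fderiv_pair_apply hYz hPz, hV P z hz, hlp hz,
      sub_neg_eq_add, add_comm]
    simp only [gBracket, VectorField.lieBracket_eq, neg_sub]
  have hoff : ∀ z ∉ phase Q, fderiv ℝ (fun z => pair (form P z) (Y z)) z (lift η z) = 0 :=
    fun z hz => by
      rw [fderiv_eq_zero_of_notMem hL hf0 fun h => hz (mem_phase.2 (hLQ h))]
      rfl
  -- By the Leibniz rule, `X(Π · Y)` inherits integrability from the assumed convergence of the
  -- bracket and from that of `∫ V(Π) · Y`.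
  have i1 : IntegrableOn (fun z => fderiv ℝ (fun z => pair (form P z) (Y z)) z (lift η z))
      (phase Q) := (hint.sub v1).congr_fun leibniz.symm hm
  have i1' := i1.integrable_of_forall_notMem_eq_zero hoff
  -- Integrability of `Π · Y` is differentiability of `K` at `Π` tested in the direction `Π` itself.
  have i0 := (hY.2 P).1.integrable_of_forall_notMem_eq_zero fun z hz => by
    rw [form_eq_zero_of_notMem_phase P hz, pair_zero_left]
  have hz := integral_fderiv_lift_eq_zero hη hL hf hf0 i0 i1'
  rw [← setIntegral_eq_integral_of_forall_compl_eq_zero hoff, setIntegral_congr_fun hm leibniz,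
    integral_sub hint v1, sub_eq_zero] at hz
  exact hz

end PlasmaFluid

end

theorem mainTheorem9 (Q : TopologicalSpace.Opens PlasmaFluid.E3) :
    PlasmaFluid.LiftIsHom Q ∧
    ∃ Φ : PlasmaFluid.MomentumForm Q →ₗ[ℝ] PlasmaFluid.FluidDual Q,
      PlasmaFluid.IsPlasmaToFluid Φ ∧
      PlasmaFluid.IsGaugeInvariant Φ ∧
      PlasmaFluid.IsDualOfLift Φ ∧
      PlasmaFluid.IsMomentumMap Φ ∧
      PlasmaFluid.IsPoissonMap Φ :=
  ⟨PlasmaFluid.liftIsHom Q, PlasmaFluid.plasmaToFluid Q,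
    PlasmaFluid.isPlasmaToFluid_plasmaToFluid, PlasmaFluid.isGaugeInvariant_plasmaToFluid,
    PlasmaFluid.isDualOfLift_plasmaToFluid, PlasmaFluid.isMomentumMap_plasmaToFluid,
    PlasmaFluid.isPoissonMap_plasmaToFluid⟩
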